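/- All graphs are finite, undirected and simple. Write $G-X$ for the graph obtained from $G$ by deleting the vertices in $X$, $i(G)$ for the number of isolated vertices of $G$, $K_m$ for the complete graph on $m$ vertices, $mK_2$ for the disjoint union of $m$ copies of $K_2$, and $G_1+G_2$ for the join of $G_1$ and $G_2$. A graph is $k$-connected if it has more than $k$ vertices and remains connected after the deletion of any fewer than $k$ vertices. The isolated toughness of $G$ is $I(G)=+\infty$ if $G$ is complete, and otherwise $$I(G)=\min\left\{\frac{|X|}{i(G-X)} : X\subseteq V(G),\ i(G-X)\ge 2\right\}.$$ For $k\ge2$, a $P_{\ge k}$-factor of $G$ is a spanning subgraph of $G$ each of whose components is a path with at least $k$ vertices. $G$ is $(P_{\ge k},n)$-factor critical avoidable if for every $W\subseteq V(G)$ with $|W|=n$ and every edge $e$ of $G-W$, the graph $G-W$ has a $P_{\ge k}$-factor that does not contain $e$. Theorem 8. Let $n,r\ge0$ be integers. (1) If $G$ is an $(n+r+2)$-connected graph with $I(G)>\frac{n+3(r+2)}{2(r+2)}$, then $G$ is $(P_{\ge3},n)$-factor critical avoidable. (2) The strict inequality in (1) cannot be weakened to $\ge$: the graph $G=K_{n+r+2}+(2r+4)K_2$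 is $(n+r+2)$-connected with $I(G)=\frac{n+3(r+2)}{2(r+2)}$, and it is not $(P_{\ge3},n)$-factor critical avoidable. (3) The connectivity in (1) cannot be lowered to $n+r+1$ when $n\ge1$: in that case the graph $G=K_{n+r+1}+(2r+2)K_2$ is $(n+r+1)$-connected with $I(G)>\frac{n+3(r+2)}{2(r+2)}$, and it is not $(P_{\ge3},n)$-factor critical avoidable. -/

import Mathlib

namespace PathFactor

open SimpleGraph

/-- `G` is `k`-connected: it has more than `k` vertices, and deleting fewer than `k` vertices
never disconnects it. -/
def IsKConnected {V : Type*} (k : ℕ) (G : SimpleGraph V) : Prop :=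
  k < Nat.card V ∧ ∀ X : Set V, X.ncard < k → (G.induce Xᶜ).Connected

/-- `i(G)`, the number of isolated vertices of `G`. -/
noncomputable def numIsolated {V : Type*} (G : SimpleGraph V) : ℕ :=
  {v : V | G.IsIsolated v}.ncard

open Classical in
/-- The isolated toughness `I(G)`: `+∞` for a complete graph, and otherwise the least value of
`|X| / i(G - X)` over the vertex sets `X` with `i(G - X) ≥ 2`. -/
noncomputable def isolatedToughness {V : Type*} (G : SimpleGraph V) : EReal :=
  if G = ⊤ then ⊤
  else ⨅ (X : Set V) (_ : 2 ≤ numIsolated (G.induce Xᶜ)),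
    (((X.ncard : ℝ) / (numIsolated (G.induce Xᶜ) : ℝ) : ℝ) : EReal)

/-- `F` is a `P_{≥k}`-factor of `G`: a spanning subgraph of `G` each of whose components is a path
of order at least `2` and at least `k`. -/
def IsPathFactor {V : Type*} (k : ℕ) (G F : SimpleGraph V) : Prop :=
  F ≤ G ∧ ∀ C : F.ConnectedComponent,
    ∃ m : ℕ, 2 ≤ m ∧ k ≤ m ∧ Nonempty (C.toSimpleGraph ≃g pathGraph m)

/-- `G` is `P_{≥k}`-factor avoidable: for each edge `e` of `G` there is a `P_{≥k}`-factor of `G`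
that does not use `e`. -/
def IsFactorAvoidable {V : Type*} (k : ℕ) (G : SimpleGraph V) : Prop :=
  ∀ e ∈ G.edgeSet, ∃ F : SimpleGraph V, IsPathFactor k G F ∧ e ∉ F.edgeSet

/-- `G` is `(P_{≥k}, n)`-factor critical avoidable: `G - W` is `P_{≥k}`-factor avoidable for every
set `W` of `n` vertices. -/
def IsFactorCriticalAvoidable {V : Type*} (k n : ℕ) (G : SimpleGraph V) : Prop :=
  ∀ W : Finset V, W.card = n → IsFactorAvoidable k (G.induce ((W : Set V)ᶜ))

/-- The join of two graphs: their disjoint union together with all edges between them. -/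
def join {V W : Type*} (G : SimpleGraph V) (H : SimpleGraph W) : SimpleGraph (V ⊕ W) where
  Adj
    | Sum.inl u, Sum.inl v => G.Adj u v
    | Sum.inr u, Sum.inr v => H.Adj u v
    | _, _ => True
  symm.symm
    | Sum.inl _, Sum.inl _ => G.adj_symm
    | Sum.inr _, Sum.inr _ => H.adj_symm
    | Sum.inl _, Sum.inr _ | Sum.inr _, Sum.inl _ => id
  loopless.irrefl
    | Sum.inl u => G.loopless.irrefl u
    | Sum.inr u => H.loopless.irrefl u

/-- `m K₂`, the disjoint union of `m` copies of `K₂`. -/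
def copiesK2 (m : ℕ) : SimpleGraph (Fin m × Fin 2) :=
  (⊥ : SimpleGraph (Fin m)) □ (⊤ : SimpleGraph (Fin 2))

/-- `K_a + m K₂`, the join of `K_a` and `m` disjoint copies of `K₂`. -/
def completeJoinK2 (a m : ℕ) : SimpleGraph (Fin a ⊕ Fin m × Fin 2) :=
  join (⊤ : SimpleGraph (Fin a)) (copiesK2 m)

end PathFactor

/-!
Part (1) rests on Kaneko's criterion: a graph has a `P_{≥3}`-factor if, for every vertex set `S`,
deleting `S` leaves at most `2|S|` sun components. It is proved by induction on the number of
vertices and then of edges. If equality holds for a nonempty `S`, Hall's theorem lets every vertex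
of `S` absorb two suns, and induction handles the rest. Otherwise no edge can be deleted without
violating the criterion, which forces every vertex of degree at least two to carry a leaf; by
induction the graph is then the corona of a factor-critical graph, that is, a sun, contradicting
the criterion for `S = ∅`.

If `G - W - e` violates the criterion at `S`, the connectivity of `G` gives `|S| ≥ r + 2`. Half of
the vertices of a sun with more than one vertex form an independent set whose neighbours within
the sun lie in the other half, so deleting `W ∪ S` together with the latter for each sun isolates
enough vertices to contradict the bound on the isolated toughness.

In `K_{n+s} + 2s K₂`, delete `n` vertices of the clique. Every copy of `K₂` needs an edge of the
factor into the remaining `s` vertices, and the copy containing the avoided edge needs two, but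
only `2s` such edges are available.
-/

namespace PathFactor

open SimpleGraph
open scoped Finset

/-! ### Path covers and path factors -/

section PathList

variable {V : Type*} {G H : SimpleGraph V}

/-- `l` lists the vertices of a path of `G`, in order. -/
def IsPathList (G : SimpleGraph V) (l : List V) : Prop :=
  l.IsChain G.Adj ∧ l.Nodup

namespace IsPathList

variable {u v : V} {l p q : List V}

lemma mono (hGH : G ≤ H) (h : IsPathList G l) : IsPathList H l :=
  ⟨h.1.imp fun _ _ hab => hGH hab, h.2⟩

lemma reverse (h : IsPathList G l) : IsPathList G l.reverse :=
  ⟨List.isChain_reverse.2 (h.1.imp fun _ _ hab => hab.symm), List.nodup_reverse.2 h.2⟩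

lemma cons (h : IsPathList G (v :: p)) (huv : G.Adj u v) (hu : u ∉ v :: p) :
    IsPathList G (u :: v :: p) :=
  ⟨List.isChain_cons_cons.2 ⟨huv, h.1⟩, List.nodup_cons.2 ⟨hu, h.2⟩⟩

lemma reverse_append (hp : IsPathList G (u :: p)) (hq : IsPathList G (v :: q)) (huv : G.Adj u v)
    (hdisj : List.Disjoint (u :: p) (v :: q)) : IsPathList G ((u :: p).reverse ++ v :: q) := by
  refine ⟨List.isChain_append.2 ⟨hp.reverse.1, hq.1, ?_⟩,
    List.nodup_append'.2 ⟨hp.reverse.2, hq.2, (List.reverse_perm _).disjoint_left.2 hdisj⟩⟩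
  simpa using huv

end IsPathList

end PathList

section PathCoverable

variable {V : Type*} [DecidableEq V] {G H : SimpleGraph V} {A B D E : Finset V} {u v : V} {k l : ℕ}

/-- The vertex set `A` is partitioned into paths of `G` with at least three vertices each. This is
a `P_{≥3}`-factor of `G[A]`, in a form suited to building factors path by path. -/
inductive PathCoverable (G : SimpleGraph V) : Finset V → Prop
  | empty : PathCoverable G ∅
  | cons {l : List V} {A : Finset V} : IsPathList G l → 3 ≤ l.length → Disjoint l.toFinset A →
      PathCoverable G A → PathCoverable G (l.toFinset ∪ A)

namespace PathCoverable

lemma mono (hGH : G ≤ H) (h : PathCoverable G A) : PathCoverable H A := by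
  induction h with
  | empty => exact .empty
  | cons hl hlen hdisj _ ih => exact .cons (hl.mono hGH) hlen hdisj ih

lemma union (hA : PathCoverable G A) (hB : PathCoverable G B) (hdisj : Disjoint A B) :
    PathCoverable G (A ∪ B) := by
  induction hA with
  | empty => simpa using hB
  | cons hl hlen hlA _ ih =>
    rw [Finset.disjoint_union_left] at hdisj
    rw [Finset.union_assoc]
    exact .cons hl hlen (Finset.disjoint_union_right.2 ⟨hlA, hdisj.1⟩) (ih hdisj.2)

lemma of_sdiff (hB : PathCoverable G B) (hAB : PathCoverable G (A \ B)) (hBA : B ⊆ A) :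
    PathCoverable G A :=
  Finset.union_sdiff_of_subset hBA ▸ hB.union hAB Finset.disjoint_sdiff

lemma biUnion {ι : Type*} {s : Finset ι} {f : ι → Finset V}
    (h : ∀ i ∈ s, PathCoverable G (f i)) (hdisj : (s : Set ι).PairwiseDisjoint f) :
    PathCoverable G (s.biUnion f) := by
  classical
  induction s using Finset.induction_on with
  | empty => simpa using PathCoverable.empty
  | insert a s ha ih =>
    rw [Finset.coe_insert, Set.pairwiseDisjoint_insert_of_notMem (by simpa using ha)] at hdisj
    rw [Finset.forall_mem_insert] at h
    rw [Finset.biUnion_insert]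
    exact h.1.union (ih h.2 hdisj.1) ((Finset.disjoint_biUnion_right ..).2 hdisj.2)

end PathCoverable

/-- `D` is partitioned into a path with first vertex `v` and at least `k` vertices, and further
paths with at least three vertices each. Such a set is completed to a path coverable one by
attaching something to `v`. -/
def HangsAt (G : SimpleGraph V) (k : ℕ) (D : Finset V) (v : V) : Prop :=
  ∃ p B, IsPathList G (v :: p) ∧ k ≤ (v :: p).length ∧ Disjoint (v :: p).toFinset B ∧
    PathCoverable G B ∧ D = (v :: p).toFinset ∪ B

lemma hangsAt_singleton (G : SimpleGraph V) (v : V) : HangsAt G 1 {v} v :=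
  ⟨[], ∅, by simp [IsPathList], by simp, by simp, .empty, by simp⟩

lemma hangsAt_pair (huv : G.Adj u v) : HangsAt G 2 {u, v} u :=
  ⟨[v], ∅, by simp [IsPathList, huv, huv.ne], by simp, by simp, .empty, by simp⟩

namespace HangsAt

lemma of_le (h : HangsAt G k D v) (hlk : l ≤ k) : HangsAt G l D v := by
  obtain ⟨p, B, hp, hlen, hdisj, hB, rfl⟩ := h
  exact ⟨p, B, hp, hlk.trans hlen, hdisj, hB, rfl⟩

lemma pathCoverable (h : HangsAt G k D v) (hk : 3 ≤ k) : PathCoverable G D := by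
  obtain ⟨p, B, hp, hlen, hdisj, hB, rfl⟩ := h
  exact .cons hp (hk.trans hlen) hdisj hB

lemma insert (h : HangsAt G k D v) (huv : G.Adj u v) (hu : u ∉ D) :
    HangsAt G (k + 1) (insert u D) u := by
  obtain ⟨p, B, hp, hlen, hdisj, hB, rfl⟩ := h
  simp only [Finset.mem_union, List.mem_toFinset, not_or] at hu
  refine ⟨v :: p, B, hp.cons huv hu.1, by simpa using hlen, ?_, hB, by simp⟩
  rw [List.toFinset_cons, Finset.disjoint_insert_left]
  exact ⟨hu.2, hdisj⟩

lemma union (h : HangsAt G k D v) (hE : PathCoverable G E) (hDE : Disjoint D E) :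
    HangsAt G k (D ∪ E) v := by
  obtain ⟨p, B, hp, hlen, hdisj, hB, rfl⟩ := h
  rw [Finset.disjoint_union_left] at hDE
  exact ⟨p, B ∪ E, hp, hlen, Finset.disjoint_union_right.2 ⟨hdisj, hDE.1⟩, hB.union hE hDE.2,
    Finset.union_assoc _ _ _⟩

lemma pathCoverable_union (hD : HangsAt G k D u) (hE : HangsAt G l E v) (huv : G.Adj u v)
    (hDE : Disjoint D E) (hkl : 3 ≤ k + l) : PathCoverable G (D ∪ E) := by
  obtain ⟨p, B, hp, hplen, hpB, hB, rfl⟩ := hD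
  obtain ⟨q, C, hq, hqlen, hqC, hC, rfl⟩ := hE
  rw [Finset.disjoint_union_left, Finset.disjoint_union_right, Finset.disjoint_union_right] at hDE
  have hpath := hp.reverse_append hq huv (List.disjoint_toFinset_iff_disjoint.1 hDE.1.1)
  have hcover := PathCoverable.cons hpath (by grind) (A := B ∪ C) ?_ (hB.union hC hDE.2.2)
  · rwa [List.toFinset_append, List.toFinset_reverse, Finset.union_union_union_comm] at hcover
  · rw [List.toFinset_append, List.toFinset_reverse, Finset.disjoint_union_left,
      Finset.disjoint_union_right, Finset.disjoint_union_right]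
    exact ⟨⟨hpB, hDE.1.2⟩, hDE.2.1.symm, hqC⟩

end HangsAt

end PathCoverable

section PathFactorLocal

variable {V : Type*} {G F : SimpleGraph V} {k m : ℕ}

lemma eq_of_adj_pathGraph {i x y z : Fin m} (hx : (pathGraph m).Adj i x)
    (hy : (pathGraph m).Adj i y) (hz : (pathGraph m).Adj i z) : x = y ∨ x = z ∨ y = z := by
  simp only [pathGraph_adj, Fin.ext_iff] at *
  lia

lemma IsPathFactor.eq_of_adj (h : IsPathFactor k G F) {v x y z : V} (hx : F.Adj v x)
    (hy : F.Adj v y) (hz : F.Adj v z) : x = y ∨ x = z ∨ y = z := by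
  obtain ⟨m, -, -, ⟨φ⟩⟩ := h.2 (F.connectedComponentMk v)
  have hv : v ∈ (F.connectedComponentMk v).supp := rfl
  have hmem (w) (hw : F.Adj v w) : w ∈ (F.connectedComponentMk v).supp :=
    ConnectedComponent.sound hw.symm.reachable
  have hadj (w) (hw : F.Adj v w) : (pathGraph m).Adj (φ ⟨v, hv⟩) (φ ⟨w, hmem w hw⟩) :=
    φ.map_adj_iff.2 hw
  simpa using eq_of_adj_pathGraph (hadj x hx) (hadj y hy) (hadj z hz)

lemma supp_connectedComponentMk_subset {s : Set V} {v : V} (hv : v ∈ s)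
    (hs : ∀ u ∈ s, ∀ w, F.Adj u w → w ∈ s) : (F.connectedComponentMk v).supp ⊆ s := by
  intro w hw
  obtain ⟨p⟩ := (ConnectedComponent.exact hw).symm
  clear hw
  induction p with
  | nil => exact hv
  | cons huv _ ih => exact ih (hs _ hv _ huv)

lemma IsPathFactor.exists_adj_ne (h : IsPathFactor 3 G F) (x y : V) :
    ∃ z, z ≠ x ∧ z ≠ y ∧ (F.Adj x z ∨ F.Adj y z) := by
  classical
  by_contra! hclosed
  obtain ⟨m, -, hm, ⟨φ⟩⟩ := h.2 (F.connectedComponentMk x)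
  have hsub : (F.connectedComponentMk x).supp ⊆ ({x, y} : Finset V) :=
    supp_connectedComponentMk_subset (by simp) (by grind)
  have hcard : (F.connectedComponentMk x).supp.ncard = m :=
    (Nat.card_congr φ.toEquiv).trans (Nat.card_fin m)
  have hle := Set.ncard_le_ncard hsub
  rw [hcard, Set.ncard_coe_finset] at hle
  have := Finset.card_le_two (a := x) (b := y)
  lia

lemma nonempty_iso_pathGraph (g : Fin m ↪ V)
    (hg : ∀ i w, F.Adj (g i) w ↔ ∃ j, (pathGraph m).Adj i j ∧ g j = w) (i : Fin m) :
    Nonempty ((F.connectedComponentMk (g i)).toSimpleGraph ≃g pathGraph m) := by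
  have hadj (j k) : F.Adj (g j) (g k) ↔ (pathGraph m).Adj j k := by simp [hg]
  have hreach (j) : F.Reachable (g j) (g i) := by
    have := Fin.pos i
    obtain ⟨n, rfl⟩ := Nat.exists_eq_add_one.2 this
    exact ((pathGraph_connected n).preconnected j i).map ⟨g, (hadj _ _).2⟩
  have hsupp : (F.connectedComponentMk (g i)).supp ⊆ Set.range g :=
    supp_connectedComponentMk_subset ⟨i, rfl⟩ (by
      rintro _ ⟨j, rfl⟩ w hw
      obtain ⟨k, -, rfl⟩ := (hg j w).1 hw
      exact ⟨k, rfl⟩)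
  let e (j : Fin m) : F.connectedComponentMk (g i) := ⟨g j, ConnectedComponent.sound (hreach j)⟩
  have he : Function.Bijective e := by
    refine ⟨fun j k hjk => g.injective (congrArg Subtype.val hjk), fun ⟨w, hw⟩ => ?_⟩
    obtain ⟨j, rfl⟩ := hsupp hw
    exact ⟨j, rfl⟩
  exact ⟨(RelIso.mk (Equiv.ofBijective e he) (hadj _ _)).symm⟩

lemma IsPathList.map_pathGraph_le {l : List V} (hl : IsPathList G l) :
    (pathGraph l.length).map l.get ≤ G := by
  have hchain := List.isChain_iff_getElem.1 hl.1
  rintro _ _ ⟨-, i, j, hij, rfl, rfl⟩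
  rcases pathGraph_adj.1 hij with hij | hij
  · simpa [hij] using hchain i (by lia)
  · simpa [hij] using (hchain j (by lia)).symm

end PathFactorLocal

section PathCoverableFactor

variable {V : Type*} [DecidableEq V] {G : SimpleGraph V} {A : Finset V}

lemma PathCoverable.exists_paths (h : PathCoverable G A) :
    ∃ F ≤ G, (∀ u w, F.Adj u w → u ∈ A) ∧ ∀ v ∈ A, ∃ m, ∃ g : Fin m ↪ V, 3 ≤ m ∧
      v ∈ Set.range g ∧ (∀ i, g i ∈ A) ∧
      ∀ i w, F.Adj (g i) w ↔ ∃ j, (pathGraph m).Adj i j ∧ g j = w := by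
  induction h with
  | empty => exact ⟨⊥, bot_le, by simp, by simp⟩
  | @cons l A hl hlen hdisj _ ih =>
  obtain ⟨F, hFG, hFA, hF⟩ := ih
  set g : Fin l.length ↪ V := ⟨l.get, List.nodup_iff_injective_get.1 hl.2⟩
  have hgl (i) : g i ∈ l := l.get_mem i
  have hgA (i) : g i ∉ A := Finset.disjoint_left.1 hdisj (List.mem_toFinset.2 (hgl i))
  refine ⟨(pathGraph l.length).map g ⊔ F, sup_le hl.map_pathGraph_le hFG, ?_, fun v hv => ?_⟩
  · rintro u w (h | h)
    · obtain ⟨-, i, -, -, rfl, -⟩ := h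
      simp [hgl]
    · simp [hFA u w h]
  rcases Finset.mem_union.1 hv with hv | hv
  · refine ⟨l.length, g, hlen, List.mem_iff_get.1 (List.mem_toFinset.1 hv), by simp [hgl], ?_⟩
    intro i w
    have hFi : ¬ F.Adj (g i) w := fun h => hgA i (hFA _ _ h)
    simp [hFi, SimpleGraph.map_adj]
  · obtain ⟨m, f, hm, hvf, hfA, hf⟩ := hF v hv
    refine ⟨m, f, hm, hvf, fun i => Finset.mem_union_right _ (hfA i), fun i w => ?_⟩
    rw [sup_adj, ← hf i w, or_iff_right]
    rintro ⟨-, j, -, -, hj, -⟩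
    exact hgA j (hj ▸ hfA i)

lemma PathCoverable.exists_isPathFactor (h : PathCoverable G A) :
    ∃ F ≤ G, IsPathFactor 3 (G.induce A) (F.induce A) := by
  obtain ⟨F, hFG, -, hF⟩ := h.exists_paths
  refine ⟨F, hFG, fun u w huw => hFG huw, fun C => ?_⟩
  induction C using ConnectedComponent.ind with
  | _ v =>
  obtain ⟨m, g, hm, ⟨i, hi⟩, hgA, hg⟩ := hF v v.2
  let f : Fin m ↪ (A : Set V) := ⟨fun j => ⟨g j, hgA j⟩, fun j k hjk =>
    g.injective (congrArg Subtype.val hjk)⟩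
  obtain rfl : f i = v := Subtype.ext hi
  refine ⟨m, by lia, hm, nonempty_iso_pathGraph f (fun j w => ?_) i⟩
  exact (hg j w).trans <| exists_congr fun l => and_congr_right fun _ =>
    (Subtype.ext_iff (a1 := f l)).symm

end PathCoverableFactor

/-! ### Coronas of factor-critical graphs -/

section PerfectlyMatched

variable {V : Type*} {G H : SimpleGraph V} {M : Finset V} {r : V}

/-- `G[M]` has a perfect matching, given as the involution that exchanges matched vertices. -/
def PerfectlyMatched (G : SimpleGraph V) (M : Finset V) : Prop :=
  ∃ μ : V → V, ∀ r ∈ M, μ r ∈ M ∧ G.Adj r (μ r) ∧ μ (μ r) = r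

namespace PerfectlyMatched

lemma congr (h : PerfectlyMatched G M) (hGH : ∀ u ∈ M, ∀ v ∈ M, G.Adj u v → H.Adj u v) :
    PerfectlyMatched H M := by
  obtain ⟨μ, hμ⟩ := h
  exact ⟨μ, fun r hr => ⟨(hμ r hr).1, hGH _ hr _ (hμ r hr).1 (hμ r hr).2.1, (hμ r hr).2.2⟩⟩

lemma exists_mate [DecidableEq V] (h : PerfectlyMatched G M) (hr : r ∈ M) :
    ∃ s ∈ M, G.Adj r s ∧ PerfectlyMatched G (M \ {r, s}) := by
  obtain ⟨μ, hμ⟩ := h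
  exact ⟨μ r, (hμ r hr).1, (hμ r hr).2.1, μ, by grind⟩

end PerfectlyMatched

end PerfectlyMatched

section Corona

variable {V : Type*} [DecidableEq V] {G H : SimpleGraph V} {D E F M N R : Finset V} {σ : V → V}
  {r s u v x y : V}

/-- `G[D]` is the corona of a factor-critical graph `G[R]`: a leaf `σ r` is attached to every
`r ∈ R`. -/
structure IsCorona (G : SimpleGraph V) (D R : Finset V) (σ : V → V) : Prop where
  nonempty : R.Nonempty
  eq_union : D = R ∪ R.image σ
  injOn : Set.InjOn σ R
  notMem : ∀ r ∈ R, σ r ∉ R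
  adj : ∀ r ∈ R, G.Adj r (σ r)
  leaf : ∀ r ∈ R, ∀ z ∈ D, G.Adj (σ r) z → z = r
  critical : ∀ r ∈ R, PerfectlyMatched G (R.erase r)

namespace IsCorona

lemma mem_iff (h : IsCorona G D R σ) ⦃x : V⦄ : x ∈ D ↔ x ∈ R ∨ ∃ r ∈ R, σ r = x := by
  rw [h.eq_union, Finset.mem_union, Finset.mem_image]

lemma mem_base (h : IsCorona G D R σ) ⦃r : V⦄ (hr : r ∈ R) : r ∈ D :=
  h.mem_iff.2 (.inl hr)

lemma mem_leaf (h : IsCorona G D R σ) ⦃r : V⦄ (hr : r ∈ R) : σ r ∈ D :=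
  h.mem_iff.2 (.inr ⟨r, hr, rfl⟩)

lemma leaf_ne (h : IsCorona G D R σ) ⦃r s : V⦄ (hr : r ∈ R) (hs : s ∈ R) : σ r ≠ s :=
  fun hrs => h.notMem r hr (hrs ▸ hs)

lemma leaf_inj (h : IsCorona G D R σ) ⦃r s : V⦄ (hr : r ∈ R) (hs : s ∈ R) : σ r = σ s ↔ r = s :=
  h.injOn.eq_iff hr hs

lemma disjoint_pair (h : IsCorona G D R σ) (hr : r ∈ R) (hs : s ∈ R) (hrs : r ≠ s) :
    Disjoint {r, σ r} ({s, σ s} : Finset V) := by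
  simp [hrs.symm, (h.leaf_ne hr hs).symm, h.leaf_ne hs hr, h.leaf_inj hs hr]

lemma union_image_sdiff (h : IsCorona G D R σ) (hNM : N ⊆ M) (hMR : M ⊆ R) :
    (M ∪ M.image σ) \ (N ∪ N.image σ) = M \ N ∪ (M \ N).image σ := by
  have hdisj {S T : Finset V} (hS : S ⊆ R) (hT : T ⊆ R) : Disjoint S (T.image σ) := by
    rw [Finset.disjoint_right, Finset.forall_mem_image]
    exact fun r hr hrS => h.notMem r (hT hr) (hS hrS)
  rw [Finset.union_sdiff_distrib, Finset.image_sdiff_of_injOn (h.injOn.mono (mod_cast hMR)) hNM,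
    Finset.sdiff_union_distrib, Finset.sdiff_union_distrib,
    Finset.sdiff_eq_self_of_disjoint (hdisj hMR (hNM.trans hMR)),
    Finset.sdiff_eq_self_of_disjoint (hdisj (hNM.trans hMR) hMR).symm,
    Finset.inter_eq_left.2 Finset.sdiff_subset, Finset.inter_eq_right.2 Finset.sdiff_subset]

lemma pathCoverable_union_image (h : IsCorona G D R σ) (hM : PerfectlyMatched G M)
    (hMR : M ⊆ R) : PathCoverable G (M ∪ M.image σ) := by
  induction M using Finset.strongInduction with
  | H M ih =>
  obtain rfl | ⟨r, hr⟩ := M.eq_empty_or_nonempty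
  · simpa using PathCoverable.empty
  obtain ⟨s, hs, hrs, hMrs⟩ := hM.exists_mate hr
  have hpair : {r, s} ⊆ M := by grind
  have hrest := ih (M \ {r, s}) (Finset.sdiff_ssubset hpair (by simp)) hMrs
    (Finset.sdiff_subset.trans hMR)
  have hfour := (hangsAt_pair (h.adj r (hMR hr))).pathCoverable_union
    (hangsAt_pair (h.adj s (hMR hs))) hrs (h.disjoint_pair (hMR hr) (hMR hs) hrs.ne) (by norm_num)
  rw [← h.union_image_sdiff hpair hMR] at hrest
  refine .of_sdiff ?_ hrest (Finset.union_subset_union hpair (Finset.image_mono _ hpair))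
  rwa [Finset.image_insert, Finset.image_singleton, Finset.insert_eq r, Finset.insert_eq (σ r),
    Finset.union_union_union_comm]

lemma pathCoverable_sdiff_pair (h : IsCorona G D R σ) (hr : r ∈ R) :
    PathCoverable G (D \ {r, σ r}) := by
  have hsplit := h.union_image_sdiff (Finset.singleton_subset_iff.2 hr) subset_rfl
  rw [Finset.image_singleton, ← Finset.insert_eq, ← Finset.erase_eq, ← h.eq_union] at hsplit
  rw [hsplit]
  exact h.pathCoverable_union_image (h.critical r hr) (Finset.erase_subset r R)

lemma exists_adj_pathCoverable_sdiff (h : IsCorona G D R σ) (hx : x ∈ R) (hr : r ∈ R)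
    (hrx : r ≠ x) :
    ∃ s ∈ R, s ≠ x ∧ G.Adj r s ∧ PathCoverable G (D \ ({x, r, s} ∪ {σ x, σ r, σ s})) := by
  obtain ⟨s, hs, hrs, hM⟩ := (h.critical x hx).exists_mate (Finset.mem_erase.2 ⟨hrx, hr⟩)
  obtain ⟨hsx, hs⟩ := Finset.mem_erase.1 hs
  refine ⟨s, hs, hsx, hrs, ?_⟩
  have hsplit := h.union_image_sdiff (N := {x, r, s}) (by grind) subset_rfl
  rw [Finset.image_insert, Finset.image_insert, Finset.image_singleton, ← h.eq_union] at hsplit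
  rw [hsplit]
  rw [show R.erase x \ {r, s} = R \ {x, r, s} by grind] at hM
  exact h.pathCoverable_union_image hM Finset.sdiff_subset

lemma hangsAt (h : IsCorona G D R σ) (hv : v ∈ D) : HangsAt G 2 D v := by
  obtain ⟨r, hr, hvr⟩ : ∃ r ∈ R, v = r ∨ v = σ r := by
    rcases h.mem_iff.1 hv with hv | ⟨r, hr, rfl⟩
    exacts [⟨v, hv, .inl rfl⟩, ⟨r, hr, .inr rfl⟩]
  have hpair : HangsAt G 2 {r, σ r} v := by
    rcases hvr with rfl | rfl
    exacts [hangsAt_pair (h.adj _ hr), Finset.pair_comm r (σ r) ▸ hangsAt_pair (h.adj r hr).symm]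
  have := hpair.union (h.pathCoverable_sdiff_pair hr) Finset.disjoint_sdiff
  rwa [Finset.union_sdiff_of_subset] at this
  simp [Finset.insert_subset_iff, h.mem_base hr, h.mem_leaf hr]

lemma pathCoverable_erase_leaf (h : IsCorona G D R σ) (hr : r ∈ R) (hR : R ≠ {r}) :
    PathCoverable G (D.erase (σ r)) := by
  obtain ⟨x, hx, hxr⟩ := ((Finset.nontrivial_iff_ne_singleton hr).2 hR).exists_ne r
  obtain ⟨s, hs, -, hrs, -⟩ := h.exists_adj_pathCoverable_sdiff hx hr hxr.symm
  obtain ⟨t, ht, hts, hrt, hrest⟩ := h.exists_adj_pathCoverable_sdiff hs hr hrs.ne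
  have hst := h.disjoint_pair hs ht hts.symm
  have hsr := h.disjoint_pair hs hr hrs.ne.symm
  have hrt' := h.disjoint_pair hr ht hrt.ne
  have hfive := (hangsAt_pair (h.adj s hs)).pathCoverable_union
    ((hangsAt_pair (h.adj t ht)).insert hrt (by grind [Finset.disjoint_left])) hrs.symm
    (by grind [Finset.disjoint_left]) (by norm_num)
  refine hfive.of_sdiff ?_ ?_
  · convert hrest using 1
    grind
  · grind [h.mem_base, h.mem_leaf, (h.adj r hr).ne, Finset.disjoint_left]

lemma pathCoverable_union_of_adj_base_leaf (h : IsCorona G D R σ) (hx : x ∈ R) (hr : r ∈ R)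
    (hxy : G.Adj x y) (hrs : G.Adj (σ r) s) (hE : HangsAt G 1 E y) (hF : HangsAt G 1 F s)
    (hDE : Disjoint D E) (hDF : Disjoint D F) (hEF : Disjoint E F) :
    PathCoverable G (D ∪ E ∪ F) := by
  have hr₁ := h.mem_base hr
  have hr₂ := h.mem_leaf hr
  by_cases hrx : r = x
  · subst hrx
    have hjoin := ((hE.insert hxy (Finset.disjoint_left.1 hDE hr₁)).insert (h.adj r hr).symm
      (by grind [Finset.disjoint_left, (h.adj r hr).ne])).pathCoverable_union
      hF hrs (by grind [Finset.disjoint_left]) (by norm_num)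
    refine hjoin.of_sdiff ?_ (by grind)
    convert h.pathCoverable_sdiff_pair hr using 1
    grind [Finset.disjoint_left]
  · obtain ⟨t, ht, htx, hrt, hrest⟩ := h.exists_adj_pathCoverable_sdiff hx hr hrx
    have hx₁ := h.mem_base hx
    have hx₂ := h.mem_leaf hx
    have ht₁ := h.mem_base ht
    have ht₂ := h.mem_leaf ht
    have hrt' := h.disjoint_pair hr ht hrt.ne
    have hxr' := h.disjoint_pair hx hr (Ne.symm hrx)
    have hxt' := h.disjoint_pair hx ht htx.symm
    have hleft := ((hE.insert hxy (Finset.disjoint_left.1 hDE hx₁)).insert (h.adj x hx).symm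
      (by grind [Finset.disjoint_left, (h.adj x hx).ne])).pathCoverable le_rfl
    have hright := ((hangsAt_pair (h.adj t ht)).insert hrt
      (by grind [Finset.disjoint_left])).pathCoverable_union
      (hF.insert hrs (Finset.disjoint_left.1 hDF hr₂)) (h.adj r hr)
      (by grind [Finset.disjoint_left, (h.adj r hr).ne]) (by norm_num)
    refine (hleft.union hright (by grind [Finset.disjoint_left])).of_sdiff ?_ ?_
    · convert hrest using 1
      ext z
      simp only [Finset.mem_sdiff, Finset.mem_union, Finset.mem_insert, Finset.mem_singleton]
      grind [Finset.disjoint_left]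
    · simp only [Finset.union_subset_iff, Finset.insert_subset_iff]
      grind

lemma pathCoverable_union_of_adj_leaf (h : IsCorona G D R σ) (hr : r ∈ R) (hR : R ≠ {r})
    (hv : v ∈ D) (hry : G.Adj (σ r) y) (hvs : G.Adj v s) (hE : HangsAt G 1 E y)
    (hF : HangsAt G 1 F s) (hDE : Disjoint D E) (hDF : Disjoint D F) (hEF : Disjoint E F) :
    PathCoverable G (D ∪ E ∪ F) := by
  have hr₁ := h.mem_base hr
  have hr₂ := h.mem_leaf hr
  rcases h.mem_iff.1 hv with hvR | ⟨x, hx, rfl⟩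
  · rw [Finset.union_right_comm]
    exact h.pathCoverable_union_of_adj_base_leaf hvR hr hvs hry hF hE hDF hDE hEF.symm
  by_cases hrx : r = x
  · subst hrx
    have hjoin := (hE.insert hry (Finset.disjoint_left.1 hDE hr₂)).pathCoverable_union hF hvs
      (by grind [Finset.disjoint_left]) (by norm_num)
    refine hjoin.of_sdiff ?_ (by grind)
    convert h.pathCoverable_erase_leaf hr hR using 1
    grind [Finset.disjoint_left]
  · obtain ⟨t, ht, htx, hrt, hrest⟩ := h.exists_adj_pathCoverable_sdiff hx hr hrx
    have hx₁ := h.mem_base hx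
    have ht₁ := h.mem_base ht
    have ht₂ := h.mem_leaf ht
    have hrt' := h.disjoint_pair hr ht hrt.ne
    have hxr' := h.disjoint_pair hx hr (Ne.symm hrx)
    have hxt' := h.disjoint_pair hx ht htx.symm
    have hleft := ((hF.insert hvs (Finset.disjoint_left.1 hDF hv)).insert (h.adj x hx)
      (by grind [Finset.disjoint_left, (h.adj x hx).ne])).pathCoverable le_rfl
    have hright := ((hangsAt_pair (h.adj t ht)).insert hrt
      (by grind [Finset.disjoint_left])).pathCoverable_union
      (hE.insert hry (Finset.disjoint_left.1 hDE hr₂)) (h.adj r hr)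
      (by grind [Finset.disjoint_left, (h.adj r hr).ne]) (by norm_num)
    refine (hleft.union hright (by grind [Finset.disjoint_left])).of_sdiff ?_ ?_
    · convert hrest using 1
      ext z
      simp only [Finset.mem_sdiff, Finset.mem_union, Finset.mem_insert, Finset.mem_singleton]
      grind [Finset.disjoint_left]
    · simp only [Finset.union_subset_iff, Finset.insert_subset_iff]
      grind

lemma congr (h : IsCorona G D R σ) (hGH : ∀ u ∈ D, ∀ v ∈ D, G.Adj u v ↔ H.Adj u v) :
    IsCorona H D R σ where
  nonempty := h.nonempty
  eq_union := h.eq_union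
  injOn := h.injOn
  notMem := h.notMem
  adj r hr := (hGH _ (h.mem_base hr) _ (h.mem_leaf hr)).1 (h.adj r hr)
  leaf r hr z hz ha := h.leaf r hr z hz ((hGH _ (h.mem_leaf hr) _ hz).2 ha)
  critical r hr := (h.critical r hr).congr fun u hu v hv =>
    (hGH u (h.mem_base (Finset.mem_of_mem_erase hu)) v (h.mem_base (Finset.mem_of_mem_erase hv))).1

lemma pathCoverable_of_extra_adj (h : IsCorona G D R σ) (hGH : G ≤ H) (hr : r ∈ R) (hy : y ∈ D)
    (hyr : y ≠ r) (ha : H.Adj (σ r) y) : PathCoverable H D := by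
  have hadj (r) (hr : r ∈ R) : H.Adj r (σ r) := hGH (h.adj r hr)
  rcases h.mem_iff.1 hy with hyR | ⟨x, hx, rfl⟩
  · obtain ⟨t, ht, hty, hrt, hrest⟩ := h.exists_adj_pathCoverable_sdiff hyR hr hyr.symm
    have hrt' := h.disjoint_pair hr ht hrt.ne
    have hry' := h.disjoint_pair hr hyR hyr.symm
    have hyt' := h.disjoint_pair hyR ht hty.symm
    have hleft := ((hangsAt_pair (hadj t ht)).insert (hGH hrt)
      (by grind [Finset.disjoint_left])).pathCoverable le_rfl
    have hright := ((hangsAt_pair (hadj y hyR)).insert ha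
      (by grind [Finset.disjoint_left])).pathCoverable le_rfl
    refine (hleft.union hright (by grind [Finset.disjoint_left, (h.adj r hr).ne])).of_sdiff ?_ ?_
    · convert hrest.mono hGH using 1
      grind
    · simp [Finset.insert_subset_iff, h.mem_base, h.mem_leaf, *]
  · have hxr : x ≠ r := by rintro rfl; exact H.irrefl ha
    obtain ⟨t, ht, htr, hxt, hrest⟩ := h.exists_adj_pathCoverable_sdiff hr hx hxr
    have hxt' := h.disjoint_pair hx ht hxt.ne
    have hxr' := h.disjoint_pair hx hr hxr
    have htr' := h.disjoint_pair ht hr htr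
    have hsix := (((hangsAt_pair (hadj t ht)).insert (hGH hxt)
      (by grind [Finset.disjoint_left])).insert (hadj x hx).symm
      (by grind [Finset.disjoint_left, (h.adj x hx).ne])).pathCoverable_union
      (hangsAt_pair (hadj r hr).symm) ha.symm (by grind [Finset.disjoint_left]) (by norm_num)
    refine hsix.of_sdiff ?_ ?_
    · convert hrest.mono hGH using 1
      grind
    · simp [Finset.insert_subset_iff, h.mem_base, h.mem_leaf, *]

lemma swap (h : IsCorona G D {r} σ) : IsCorona G D {σ r} fun _ => r where
  nonempty := by simp
  eq_union := by rw [h.eq_union]; simp [Finset.pair_comm]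
  injOn := by simp
  notMem := by simpa using (h.adj r (by simp)).ne
  adj := by simpa using (h.adj r (by simp)).symm
  leaf := by
    have hloop : ¬ G.Adj r r := G.irrefl
    have hmem := h.mem_iff
    grind
  critical := by simpa using ⟨id, by simp⟩

lemma exists_mem_base_or_leaf (h : IsCorona G D R σ) (hx : x ∈ D) :
    (∃ R σ, IsCorona G D R σ ∧ x ∈ R) ∨ ∃ R σ, IsCorona G D R σ ∧ ∃ r ∈ R, x = σ r ∧ R ≠ {r} := by
  rcases h.mem_iff.1 hx with hr | ⟨r, hr, rfl⟩
  · exact .inl ⟨R, σ, h, hr⟩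
  · by_cases hR : R = {r}
    · subst hR
      exact .inl ⟨_, _, h.swap, by simp⟩
    · exact .inr ⟨R, σ, h, r, hr, rfl, hR⟩

end IsCorona

end Corona

/-! ### Sun components -/

section Connectivity

variable {V : Type*} {G H : SimpleGraph V} {A D : Finset V}

/-- No edge of `G[A]` leaves `D`; for `D ⊆ A` this says that `D` is a union of components of
`G[A]`. -/
def ClosedIn (G : SimpleGraph V) (A D : Finset V) : Prop :=
  ∀ u ∈ D, ∀ w ∈ A, G.Adj u w → w ∈ D

/-- `G[A]` is connected or empty. -/
def ConnectedOn (G : SimpleGraph V) (A : Finset V) : Prop :=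
  ∀ D ⊆ A, D.Nonempty → ClosedIn G A D → D = A

lemma ConnectedOn.congr (h : ConnectedOn G D) (hGH : ∀ u ∈ D, ∀ v ∈ D, G.Adj u v ↔ H.Adj u v) :
    ConnectedOn H D := fun B hB hne hc =>
  h B hB hne fun u hu w hw ha => hc u hu w hw ((hGH u (hB hu) w hw).1 ha)

end Connectivity

section Sun

variable {V : Type*} [DecidableEq V] {G H : SimpleGraph V} {A B D E N S X Y : Finset V}
  {𝒟 : Finset (Finset V)} {s v z : V}

/-- `G[D]` is a sun in Kaneko's sense: a single vertex, or a connected corona of a factor-critical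
graph (which includes `K₂`). -/
def IsSun (G : SimpleGraph V) (D : Finset V) : Prop :=
  ConnectedOn G D ∧ ((∃ v, D = {v}) ∨ ∃ R σ, IsCorona G D R σ)

namespace IsSun

lemma congr (h : IsSun G D) (hGH : ∀ u ∈ D, ∀ v ∈ D, G.Adj u v ↔ H.Adj u v) : IsSun H D :=
  ⟨h.1.congr hGH, h.2.imp_right fun ⟨R, σ, hR⟩ => ⟨R, σ, hR.congr hGH⟩⟩

lemma nonempty (h : IsSun G D) : D.Nonempty := by
  rcases h.2 with ⟨v, rfl⟩ | ⟨R, σ, hR⟩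
  · exact Finset.singleton_nonempty v
  · exact hR.nonempty.mono hR.mem_base

lemma hangsAt (h : IsSun G D) (hv : v ∈ D) : HangsAt G 1 D v := by
  rcases h.2 with ⟨u, rfl⟩ | ⟨R, σ, hR⟩
  · obtain rfl := Finset.mem_singleton.1 hv
    exact hangsAt_singleton G v
  · exact (hR.hangsAt hv).of_le one_le_two

end IsSun

lemma isSun_singleton (G : SimpleGraph V) (v : V) : IsSun G {v} :=
  ⟨fun _ hD hne _ => hne.subset_singleton_iff.1 hD, .inl ⟨v, rfl⟩⟩

open Classical in
/-- The sun components of `G[A]`. -/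
noncomputable def suns (G : SimpleGraph V) (A : Finset V) : Finset (Finset V) :=
  {D ∈ A.powerset | IsSun G D ∧ ClosedIn G A D}

lemma mem_suns : D ∈ suns G A ↔ D ⊆ A ∧ IsSun G D ∧ ClosedIn G A D := by
  simp [suns]

lemma eq_of_mem_suns (hD : D ∈ suns G A) (hE : E ∈ suns G A) (hzD : z ∈ D) (hzE : z ∈ E) :
    D = E := by
  rw [mem_suns] at hD hE
  have hne : (D ∩ E).Nonempty := ⟨z, Finset.mem_inter.2 ⟨hzD, hzE⟩⟩
  have hDE := hD.2.1.1 (D ∩ E) Finset.inter_subset_left hne fun u hu w hw ha =>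
    Finset.mem_inter.2 ⟨hw, hE.2.2 u (Finset.mem_inter.1 hu).2 w (hD.1 hw) ha⟩
  have hED := hE.2.1.1 (D ∩ E) Finset.inter_subset_right hne fun u hu w hw ha =>
    Finset.mem_inter.2 ⟨hD.2.2 u (Finset.mem_inter.1 hu).1 w (hE.1 hw) ha, hw⟩
  exact hDE.symm.trans hED

lemma pairwiseDisjoint_suns (G : SimpleGraph V) (A : Finset V) :
    (suns G A : Set (Finset V)).PairwiseDisjoint id := fun _ hD _ hE hne =>
  Finset.disjoint_left.2 fun _ hzD hzE => hne (eq_of_mem_suns hD hE hzD hzE)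

/-- Kaneko's condition for `G[A]`: deleting a set `S` of vertices leaves at most `2|S|` sun
components. -/
def SunCondition (G : SimpleGraph V) (A : Finset V) : Prop :=
  ∀ S ⊆ A, #(suns G (A \ S)) ≤ 2 * #S

/-- The sun condition with strict inequality for nonempty sets. -/
def StrictSunCondition (G : SimpleGraph V) (A : Finset V) : Prop :=
  ∀ S ⊆ A, S.Nonempty → #(suns G (A \ S)) < 2 * #S

lemma SunCondition.suns_eq_empty (h : SunCondition G A) : suns G A = ∅ := by
  simpa using h ∅ (Finset.empty_subset A)

/-- `s` has a neighbour in `D`. -/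
def Touches (G : SimpleGraph V) (s : V) (D : Finset V) : Prop :=
  ∃ v ∈ D, G.Adj s v

lemma mem_suns_of_not_touches (hSX : X ⊆ S) (hD : D ∈ suns G (A \ S))
    (hDX : ∀ s ∈ S \ X, ¬ Touches G s D) : D ∈ suns G (A \ X) := by
  obtain ⟨hDA, hsun, hcl⟩ := mem_suns.1 hD
  refine mem_suns.2 ⟨hDA.trans (Finset.sdiff_subset_sdiff subset_rfl hSX), hsun, ?_⟩
  intro u hu w hw ha
  by_cases hwS : w ∈ S
  · exact (hDX w (by grind) ⟨u, hu, ha.symm⟩).elim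
  · exact hcl u hu w (by grind) ha

lemma card_suns_sdiff_add_card_le (hN : N ⊆ A \ S) (hcl : ClosedIn G (A \ S) N)
    (h𝒟 : 𝒟 ⊆ suns G (A \ S)) (hdisj : ∀ D ∈ 𝒟, Disjoint D N) (hX : X ⊆ N) :
    #(suns G (N \ X)) + #𝒟 ≤ #(suns G (A \ (S ∪ X))) := by
  have hnew : Disjoint (suns G (N \ X)) 𝒟 := Finset.disjoint_left.2 fun D hD hD' => by
    obtain ⟨z, hz⟩ := (mem_suns.1 hD).2.1.nonempty
    exact Finset.disjoint_left.1 (hdisj D hD') hz (Finset.sdiff_subset ((mem_suns.1 hD).1 hz))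
  rw [← Finset.card_union_of_disjoint hnew]
  refine Finset.card_le_card fun D hD => ?_
  rcases Finset.mem_union.1 hD with hD | hD
  · obtain ⟨hDN, hsun, hD⟩ := mem_suns.1 hD
    refine mem_suns.2 ⟨by grind, hsun, fun u hu w hw ha => ?_⟩
    exact hD u hu w (by grind [hcl u (Finset.sdiff_subset (hDN hu)) w]) ha
  · obtain ⟨hDA, hsun, hcl⟩ := mem_suns.1 (h𝒟 hD)
    have := Finset.disjoint_left.1 (hdisj D hD)
    exact mem_suns.2 ⟨by grind, hsun, fun u hu w hw ha => hcl u hu w (by grind) ha⟩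

lemma closedIn_sdiff_biUnion_sdiff (hB : ClosedIn G A B) (h𝒟 : 𝒟 ⊆ suns G A) :
    ClosedIn G A ((A \ 𝒟.biUnion id) \ B) := by
  intro u hu w hw ha
  simp only [Finset.mem_sdiff, Finset.mem_biUnion, id, not_exists, not_and] at hu ⊢
  refine ⟨⟨hw, fun D hD hwD => hu.1.2 D hD ?_⟩, fun hwB => hu.2 (hB w hwB u hu.1.1 ha.symm)⟩
  exact (mem_suns.1 (h𝒟 hD)).2.2 w hwD u hu.1.1 ha.symm

end Sun

section Hall

lemma exists_pairwiseDisjoint_subsets_of_sum_le {ι α : Type*} [DecidableEq α]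
    {t : ι → Finset α} {c : ι → ℕ} (hc : ∀ Y : Finset ι, ∑ i ∈ Y, c i ≤ #(Y.biUnion t)) :
    ∃ P : ι → Finset α, (∀ i, P i ⊆ t i ∧ #(P i) = c i) ∧ Pairwise (Function.onFun Disjoint P) := by
  classical
  have hall (T : Finset (Σ i, Fin (c i))) : #T ≤ #(T.biUnion fun p => t p.1) := by
    calc #T ≤ #((T.image Sigma.fst).sigma fun i => (Finset.univ : Finset (Fin (c i)))) :=
          Finset.card_le_card fun p hp => by
            simpa using ⟨p.2, hp⟩
      _ = ∑ i ∈ T.image Sigma.fst, c i := by simp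
      _ ≤ #((T.image Sigma.fst).biUnion t) := hc _
      _ = #(T.biUnion fun p => t p.1) := by rw [Finset.image_biUnion]
  obtain ⟨f, hf, hft⟩ :=
    (Finset.all_card_le_biUnion_card_iff_exists_injective fun p : Σ i, Fin (c i) => t p.1).1 hall
  refine ⟨fun i => Finset.univ.image fun j => f ⟨i, j⟩, fun i => ⟨?_, ?_⟩, fun i i' hii => ?_⟩
  · simpa [Finset.image_subset_iff] using fun j => hft ⟨i, j⟩
  · rw [Finset.card_image_of_injective _ fun j j' h => sigma_mk_injective (hf h), Finset.card_fin]
  · simp only [Function.onFun, Finset.disjoint_left, Finset.mem_image, Finset.mem_univ, true_and]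
    rintro _ ⟨j, rfl⟩ ⟨j', hj⟩
    exact hii (congrArg Sigma.fst (hf hj)).symm

variable {V : Type*} [DecidableEq V] {G : SimpleGraph V} {A L S Y : Finset V}
  {P 𝒟 : Finset (Finset V)} {s : V}

lemma hangsAt_insert_biUnion_suns (hP : P ⊆ suns G A) (hcard : #P = 1) (hs : s ∉ A)
    (hsP : ∀ D ∈ P, Touches G s D) : HangsAt G 2 (insert s (P.biUnion id)) s := by
  obtain ⟨D, rfl⟩ := Finset.card_eq_one.1 hcard
  rw [Finset.singleton_subset_iff, mem_suns] at hP
  obtain ⟨v, hv, hsv⟩ := hsP D (Finset.mem_singleton_self D)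
  rw [Finset.singleton_biUnion]
  exact (hP.2.1.hangsAt hv).insert hsv fun hsD => hs (hP.1 hsD)

lemma pathCoverable_insert_biUnion_suns (hP : P ⊆ suns G A) (hcard : #P = 2) (hs : s ∉ A)
    (hsP : ∀ D ∈ P, Touches G s D) : PathCoverable G (insert s (P.biUnion id)) := by
  obtain ⟨D, E, hDE, rfl⟩ := Finset.card_eq_two.1 hcard
  simp only [Finset.forall_mem_insert, Finset.mem_singleton, forall_eq] at hsP
  have hE : E ∈ suns G A := hP (by simp)
  have hhang := hangsAt_insert_biUnion_suns (P := {D}) (fun F hF => hP (by grind))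
    (Finset.card_singleton D) hs (by simpa using hsP.1)
  obtain ⟨v, hv, hsv⟩ := hsP.2
  convert hhang.pathCoverable_union ((mem_suns.1 hE).2.1.hangsAt hv) hsv ?_ le_rfl using 1
  · grind
  · rw [Finset.singleton_biUnion, Finset.disjoint_insert_left]
    exact ⟨fun hsE => hs ((mem_suns.1 hE).1 hsE),
      pairwiseDisjoint_suns G A (hP (by simp)) hE hDE⟩

lemma sum_ite_mem_add_card_inter (L Y : Finset V) :
    (∑ s ∈ Y, if s ∈ L then 1 else 2) + #(Y ∩ L) = 2 * #Y := by
  rw [Finset.card_eq_sum_ones, ← Finset.sum_ite_mem, ← Finset.sum_add_distrib,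
    Finset.card_eq_sum_ones, Finset.mul_sum]
  exact Finset.sum_congr rfl fun s _ => by split_ifs <;> rfl

open Classical in
lemma sum_ite_mem_le_card_touched_suns (hA : ∀ X ⊆ A, #(suns G (A \ X)) + #(X ∩ L) ≤ 2 * #X)
    (hS : S ⊆ A) (hL : L ⊆ S) (h𝒟 : 𝒟 ⊆ suns G (A \ S)) (hcard : #𝒟 + #L = 2 * #S) (hY : Y ⊆ S) :
    ∑ s ∈ Y, (if s ∈ L then 1 else 2) ≤ #(Y.biUnion fun s => {D ∈ 𝒟 | Touches G s D}) := by
  set 𝒩 := Y.biUnion fun s => {D ∈ 𝒟 | Touches G s D}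
  have h𝒩 : 𝒩 ⊆ 𝒟 := Finset.biUnion_subset.2 fun s _ => Finset.filter_subset _ _
  have hfree : 𝒟 \ 𝒩 ⊆ suns G (A \ (S \ Y)) := fun D hD => by
    obtain ⟨hD, hD𝒩⟩ := Finset.mem_sdiff.1 hD
    refine mem_suns_of_not_touches Finset.sdiff_subset (h𝒟 hD) fun s hs ht => hD𝒩 ?_
    rw [Finset.sdiff_sdiff_eq_self hY] at hs
    exact Finset.mem_biUnion.2 ⟨s, hs, Finset.mem_filter.2 ⟨hD, ht⟩⟩
  have hrest := hA (S \ Y) (Finset.sdiff_subset.trans hS)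
  have hLY : (S \ Y) ∩ L = L \ (Y ∩ L) := by grind
  have hsum := sum_ite_mem_add_card_inter L Y
  have := Finset.card_le_card hfree
  have := Finset.card_sdiff_add_card_eq_card h𝒩
  have := Finset.card_sdiff_add_card_eq_card hY
  have := Finset.card_sdiff_add_card_eq_card (s := Y ∩ L) (t := L) Finset.inter_subset_right
  rw [hLY] at hrest
  lia

lemma exists_assigned_suns (hA : ∀ X ⊆ A, #(suns G (A \ X)) + #(X ∩ L) ≤ 2 * #X) (hS : S ⊆ A)
    (hL : L ⊆ S) (h𝒟 : 𝒟 ⊆ suns G (A \ S)) (hcard : #𝒟 + #L = 2 * #S) :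
    ∃ P : V → Finset (Finset V), (∀ s ∈ S, ∀ D ∈ P s, Touches G s D) ∧
      (∀ s ∈ S, #(P s) = if s ∈ L then 1 else 2) ∧ (S : Set V).PairwiseDisjoint P ∧
      S.biUnion P = 𝒟 := by
  classical
  obtain ⟨P, hP, hdisj⟩ := exists_pairwiseDisjoint_subsets_of_sum_le
    (t := fun s => {D ∈ 𝒟 | Touches G s D})
    (c := fun s => if s ∈ S then if s ∈ L then 1 else 2 else 0) fun Y => by
      rw [Finset.sum_ite_mem]
      exact (sum_ite_mem_le_card_touched_suns hA hS hL h𝒟 hcard Finset.inter_subset_right).trans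
        (Finset.card_le_card (Finset.biUnion_subset_biUnion_of_subset_left _
          Finset.inter_subset_left))
  have hPcard (s) (hs : s ∈ S) : #(P s) = if s ∈ L then 1 else 2 := by simp [hP, hs]
  have hPdisj : (S : Set V).PairwiseDisjoint P := fun s _ t _ hst => hdisj hst
  refine ⟨P, fun s _ D hD => (Finset.mem_filter.1 ((hP s).1 hD)).2, hPcard, hPdisj, ?_⟩
  refine Finset.eq_of_subset_of_card_le (Finset.biUnion_subset.2 fun s _ D hD =>
    (Finset.mem_filter.1 ((hP s).1 hD)).1) ?_
  have hsum := sum_ite_mem_add_card_inter L S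
  rw [Finset.inter_eq_right.2 hL] at hsum
  rw [Finset.card_biUnion hPdisj, Finset.sum_congr rfl hPcard]
  lia

end Hall

section Stars

variable {V : Type*} [DecidableEq V] {G : SimpleGraph V} {A B L S : Finset V}
  {𝒟 : Finset (Finset V)} {s : V}

/-- `T s` consists of `s` and two suns touching it, or a single one if `s ∈ L`. -/
lemma exists_stars (hA : ∀ X ⊆ A, #(suns G (A \ X)) + #(X ∩ L) ≤ 2 * #X) (hS : S ⊆ A)
    (hL : L ⊆ S) (h𝒟 : 𝒟 ⊆ suns G (A \ S)) (hcard : #𝒟 + #L = 2 * #S) :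
    ∃ T : V → Finset V, (∀ s ∈ L, HangsAt G 2 (T s) s) ∧ (∀ s ∈ S \ L, PathCoverable G (T s)) ∧
      (S : Set V).PairwiseDisjoint T ∧ S.biUnion T = S ∪ 𝒟.biUnion id := by
  obtain ⟨P, htouch, hPcard, hdisj, hP⟩ := exists_assigned_suns hA hS hL h𝒟 hcard
  have hPsub (s) (hs : s ∈ S) : P s ⊆ suns G (A \ S) :=
    ((Finset.subset_biUnion_of_mem P hs).trans hP.subset).trans h𝒟
  have hSA (s) (hs : s ∈ S) : s ∉ A \ S := fun h => (Finset.mem_sdiff.1 h).2 hs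
  refine ⟨fun s => insert s ((P s).biUnion id), fun s hs => ?_, fun s hs => ?_, ?_, ?_⟩
  · exact hangsAt_insert_biUnion_suns (hPsub s (hL hs)) (by simp [hPcard s (hL hs), hs])
      (hSA s (hL hs)) (htouch s (hL hs))
  · obtain ⟨hs, hsL⟩ := Finset.mem_sdiff.1 hs
    exact pathCoverable_insert_biUnion_suns (hPsub s hs) (by simp [hPcard s hs, hsL]) (hSA s hs)
      (htouch s hs)
  · intro s hs t ht hst
    have hnot {s t} (hs : s ∈ S) (ht : t ∈ S) : s ∉ (P t).biUnion id := fun h => by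
      obtain ⟨D, hD, hsD⟩ := Finset.mem_biUnion.1 h
      exact hSA s hs ((mem_suns.1 (hPsub t ht hD)).1 hsD)
    refine Finset.disjoint_insert_left.2 ⟨by simpa [hst] using hnot hs ht,
      Finset.disjoint_insert_right.2 ⟨hnot ht hs, ?_⟩⟩
    simp only [Finset.disjoint_biUnion_left, Finset.disjoint_biUnion_right]
    exact fun E hE D hD => pairwiseDisjoint_suns G _ (hPsub s hs hD) (hPsub t ht hE) fun hDE =>
      Finset.disjoint_left.1 (hdisj hs ht hst) hD (hDE ▸ hE)
  · rw [← hP, Finset.biUnion_biUnion]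
    ext z
    simp only [Finset.mem_biUnion, Finset.mem_insert, Finset.mem_union]
    grind

lemma sunCondition_sdiff_stars (hA : ∀ X ⊆ A, #(suns G (A \ X)) + #(X ∩ L) ≤ 2 * #X) (hS : S ⊆ A)
    (hL : L ⊆ S) (hB : ClosedIn G (A \ S) B) (h𝒟 : 𝒟 ⊆ suns G (A \ S))
    (hcard : #𝒟 + #L = 2 * #S) : SunCondition G ((A \ B) \ (S ∪ 𝒟.biUnion id)) := by
  have hN : (A \ B) \ (S ∪ 𝒟.biUnion id) = ((A \ S) \ 𝒟.biUnion id) \ B := by grind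
  rw [hN]
  intro X hX
  have hsuns := card_suns_sdiff_add_card_le (Finset.sdiff_subset.trans Finset.sdiff_subset)
    (closedIn_sdiff_biUnion_sdiff hB h𝒟) h𝒟 (fun D hD => Finset.disjoint_left.2 fun z hz hzN => by
      simp only [Finset.mem_sdiff, Finset.mem_biUnion] at hzN
      exact hzN.1.2 ⟨D, hD, hz⟩) hX
  have hSX := hA (S ∪ X) (by grind)
  have := Finset.card_union_le S X
  have : #L ≤ #((S ∪ X) ∩ L) := Finset.card_le_card (by grind)
  lia

lemma sdiff_union_ssubset {T : Finset V} (hS : S ⊆ A) (hne : S.Nonempty) :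
    (A \ B) \ (S ∪ T) ⊂ A := by
  obtain ⟨s, hs⟩ := hne
  exact (Finset.ssubset_iff_of_subset (Finset.sdiff_subset.trans Finset.sdiff_subset)).2
    ⟨s, hS hs, by simp [hs]⟩

lemma pathCoverable_of_tight (ih : ∀ B ⊂ A, SunCondition G B → PathCoverable G B)
    (hA : SunCondition G A) (hS : S ⊆ A) (hne : S.Nonempty) (hcard : #(suns G (A \ S)) = 2 * #S) :
    PathCoverable G A := by
  have hA' (X) (hX : X ⊆ A) : #(suns G (A \ X)) + #(X ∩ ∅) ≤ 2 * #X := by simpa using hA X hX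
  have hcard' : #(suns G (A \ S)) + #(∅ : Finset V) = 2 * #S := by simpa using hcard
  obtain ⟨T, -, hcover, hdisj, hT⟩ := exists_stars hA' hS (Finset.empty_subset S) subset_rfl hcard'
  have hrest := ih _ (sdiff_union_ssubset hS hne) (sunCondition_sdiff_stars (B := ∅) hA' hS
    (Finset.empty_subset S) (by simp [ClosedIn]) subset_rfl hcard')
  rw [Finset.sdiff_empty, ← hT] at hrest
  refine (PathCoverable.biUnion (fun s hs => hcover s (by simpa using hs)) hdisj).of_sdiff hrest ?_
  rw [hT]
  exact Finset.union_subset hS (Finset.biUnion_subset.2 fun D hD =>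
    (mem_suns.1 hD).1.trans Finset.sdiff_subset)

lemma hangsAt_of_strict (ih : ∀ B ⊂ A, SunCondition G B → PathCoverable G B)
    (hA : SunCondition G A) (hA' : StrictSunCondition G A) (hS : S ⊆ A) (hs : s ∈ S)
    (hBA : B ⊆ A \ S) (hB : ClosedIn G (A \ S) B) (h𝒟 : 𝒟 ⊆ suns G (A \ S))
    (h𝒟B : ∀ D ∈ 𝒟, Disjoint D B) (hcard : #𝒟 + 1 = 2 * #S) : HangsAt G 2 (A \ B) s := by
  have hA₁ (X) (hX : X ⊆ A) : #(suns G (A \ X)) + #(X ∩ {s}) ≤ 2 * #X := by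
    by_cases hsX : s ∈ X
    · simpa [hsX] using hA' X hX ⟨s, hsX⟩
    · simpa [hsX] using hA X hX
  have hL : {s} ⊆ S := Finset.singleton_subset_iff.2 hs
  obtain ⟨T, hhang, hcover, hdisj, hT⟩ := exists_stars hA₁ hS hL h𝒟 hcard
  have hstars : HangsAt G 2 (S.biUnion T) s := by
    rw [← Finset.insert_erase hs, Finset.biUnion_insert]
    refine (hhang s (by simp)).union (.biUnion (fun t ht => hcover t (by grind))
      (hdisj.subset (mod_cast Finset.erase_subset s S))) ?_
    rw [Finset.disjoint_biUnion_right]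
    exact fun t ht => hdisj hs (Finset.mem_of_mem_erase ht) (Finset.ne_of_mem_erase ht).symm
  have hrest := ih _ (sdiff_union_ssubset hS ⟨s, hs⟩)
    (sunCondition_sdiff_stars hA₁ hS hL hB h𝒟 hcard)
  rw [← hT] at hrest
  have hTA : S.biUnion T ⊆ A \ B := by
    rw [hT]
    refine Finset.union_subset (by grind) (Finset.biUnion_subset.2 fun D hD => ?_)
    exact Finset.subset_sdiff.2 ⟨(mem_suns.1 (h𝒟 hD)).1.trans Finset.sdiff_subset, h𝒟B D hD⟩
  exact Finset.union_sdiff_of_subset hTA ▸ hstars.union hrest Finset.disjoint_sdiff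

end Stars

section Matching

variable {V : Type*} [DecidableEq V] {G : SimpleGraph V} {M : Finset V} {σ : V → V}

/-- In a path factor each base vertex `r` is joined to its leaf `σ r` and to exactly one further
vertex, which is again a base vertex. -/
lemma PathCoverable.perfectlyMatched (h : PathCoverable G (M ∪ M.image σ))
    (hσ : ∀ r ∈ M, σ r ∉ M)
    (hleaf : ∀ r ∈ M, ∀ w ∈ M ∪ M.image σ, G.Adj (σ r) w → w = r) : PerfectlyMatched G M := by
  obtain ⟨F, hFG, hF⟩ := h.exists_isPathFactor
  have hbase (r) (hr : r ∈ M) : r ∈ M ∪ M.image σ := Finset.mem_union_left _ hr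
  have hleafMem (r) (hr : r ∈ M) : σ r ∈ M ∪ M.image σ :=
    Finset.mem_union_right _ (Finset.mem_image_of_mem σ hr)
  have hFleaf (r) (hr : r ∈ M) : F.Adj r (σ r) := by
    obtain ⟨⟨z, hz⟩, -, -, hadj⟩ := hF.exists_adj_ne ⟨σ r, hleafMem r hr⟩ ⟨σ r, hleafMem r hr⟩
    have hadj : F.Adj (σ r) z := hadj.elim id id
    exact hleaf r hr z hz (hFG hadj) ▸ hadj.symm
  have hmate (r) (hr : r ∈ M) : ∃ s ∈ M, F.Adj r s := by
    obtain ⟨⟨z, hz⟩, hzr, hzσ, hadj⟩ := hF.exists_adj_ne ⟨r, hbase r hr⟩ ⟨σ r, hleafMem r hr⟩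
    have hadj : F.Adj r z := hadj.resolve_right fun hadj =>
      hzr (Subtype.ext (hleaf r hr z hz (hFG hadj)))
    rcases Finset.mem_union.1 hz with hzM | hzσM
    · exact ⟨z, hzM, hadj⟩
    · obtain ⟨t, ht, rfl⟩ := Finset.mem_image.1 hzσM
      obtain rfl := hleaf t ht r (hbase r hr) (hFG hadj.symm)
      exact (hzσ rfl).elim
  choose! μ hμM hμ using hmate
  refine ⟨μ, fun r hr => ⟨hμM r hr, hFG (hμ r hr), ?_⟩⟩
  have hs := hμM r hr
  have hthree := hF.eq_of_adj (v := ⟨μ r, hbase _ hs⟩) (x := ⟨r, hbase r hr⟩)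
    (y := ⟨μ (μ r), hbase _ (hμM _ hs)⟩) (z := ⟨σ (μ r), hleafMem _ hs⟩) (hμ r hr).symm (hμ _ hs)
    (hFleaf _ hs)
  simp only [Subtype.mk.injEq] at hthree
  rcases hthree with heq | heq | heq
  · exact heq.symm
  · exact (hσ _ hs (heq ▸ hr)).elim
  · exact (hσ _ hs (heq ▸ hμM _ hs)).elim

end Matching

/-! ### Kaneko's theorem -/

section Neighbors

variable {V : Type*} {G : SimpleGraph V} {A D : Finset V} {x y : V}

/-- `x` has at least two neighbours in `A`: for each vertex there is a neighbour different from
it. -/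
def HasTwoNeighbors (G : SimpleGraph V) (A : Finset V) (x : V) : Prop :=
  ∀ u, ∃ w ∈ A, w ≠ u ∧ G.Adj x w

lemma eq_of_not_hasTwoNeighbors (h : ¬ HasTwoNeighbors G A x) (hy : y ∈ A) (hxy : G.Adj x y)
    ⦃w : V⦄ (hw : w ∈ A) (hxw : G.Adj x w) : w = y := by
  unfold HasTwoNeighbors at h
  push Not at h
  grind

/-- In `G[A]` the vertex `p` is a leaf with neighbour `x`. -/
def IsPendant (G : SimpleGraph V) (A : Finset V) (p x : V) : Prop :=
  p ∈ A ∧ G.Adj p x ∧ ∀ w ∈ A, G.Adj p w → w = x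

/-- The set `D` is attached to the rest of `G[A]` by the single edge `xy`, where `x ∈ D`. -/
structure Dangles (G : SimpleGraph V) (A D : Finset V) (x y : V) : Prop where
  subset : D ⊆ A
  left_mem : x ∈ D
  right_mem : y ∈ A
  right_notMem : y ∉ D
  adj : G.Adj x y
  out : ∀ u ∈ D, ∀ w ∈ A, G.Adj u w → w ∈ D ∨ u = x ∧ w = y

lemma closedIn_of_closedIn_deleteEdges (h : ClosedIn (G.deleteEdges {s(x, y)}) A D)
    (hxy : x ∈ D ↔ y ∈ D) : ClosedIn G A D := by
  intro u hu w hw huw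
  by_cases hedge : s(u, w) = s(x, y)
  · rw [Sym2.eq_iff] at hedge
    grind
  · exact h u hu w hw (deleteEdges_adj.2 ⟨huw, hedge⟩)

lemma dangles_of_closedIn_deleteEdges (h : ClosedIn (G.deleteEdges {s(x, y)}) A D) (hDA : D ⊆ A)
    (hx : x ∈ D) (hyA : y ∈ A) (hy : y ∉ D) (hxy : G.Adj x y) : Dangles G A D x y := by
  refine ⟨hDA, hx, hyA, hy, hxy, fun u hu w hw huw => ?_⟩
  by_contra! hnot
  refine hnot.1 (h u hu w hw ?_)
  simp only [deleteEdges_adj, Set.mem_singleton_iff, Sym2.eq_iff]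
  grind

lemma deleteEdges_adj_iff_of_notMem (hy : y ∉ D) :
    ∀ u ∈ D, ∀ v ∈ D, (G.deleteEdges {s(x, y)}).Adj u v ↔ G.Adj u v := by
  intro u hu v hv
  simp only [deleteEdges_adj, Set.mem_singleton_iff, Sym2.eq_iff]
  grind

end Neighbors

section SunComponents

variable {V : Type*} [DecidableEq V] {G : SimpleGraph V} {A D E R : Finset V} {σ : V → V}
  {p q x y : V}

lemma card_suns_filter_mem_le_one (G : SimpleGraph V) (A : Finset V) (x : V) :
    #{D ∈ suns G A | x ∈ D} ≤ 1 := by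
  refine Finset.card_le_one.2 fun D hD E hE => ?_
  rw [Finset.mem_filter] at hD hE
  exact eq_of_mem_suns hD.1 hE.1 hD.2 hE.2

lemma mem_suns_of_mem_suns_deleteEdges (hD : D ∈ suns (G.deleteEdges {s(x, y)}) A) (hx : x ∉ D)
    (hy : y ∉ D) : D ∈ suns G A := by
  obtain ⟨hDA, hsun, hcl⟩ := mem_suns.1 hD
  refine mem_suns.2 ⟨hDA, hsun.congr (deleteEdges_adj_iff_of_notMem hy), fun u hu w hw huw => ?_⟩
  refine hcl u hu w hw ?_
  simp only [deleteEdges_adj, Set.mem_singleton_iff, Sym2.eq_iff]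
  grind

lemma SunCondition.not_isSun (h : SunCondition G A) : ¬ IsSun G A := fun hA => by
  have hmem : A ∈ suns G A := mem_suns.2 ⟨subset_rfl, hA, fun _ _ _ hw _ => hw⟩
  simp [h.suns_eq_empty] at hmem

lemma IsPendant.singleton_mem_suns (h : IsPendant G A p y) : {p} ∈ suns G (A \ {y}) := by
  refine mem_suns.2 ⟨by simpa using ⟨h.1, h.2.1.ne⟩, isSun_singleton G p, fun u hu w hw huw => ?_⟩
  obtain rfl := Finset.mem_singleton.1 hu
  simp [h.2.2 w (Finset.sdiff_subset hw) huw] at hw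

namespace StrictSunCondition

lemma eq_of_mem_suns (h : StrictSunCondition G A) (hy : y ∈ A)
    (hD : D ∈ suns G (A \ {y})) (hE : E ∈ suns G (A \ {y})) : D = E := by
  have hcard := h {y} (Finset.singleton_subset_iff.2 hy) (Finset.singleton_nonempty y)
  rw [Finset.card_singleton] at hcard
  exact Finset.card_le_one.1 (by lia) D hD E hE

lemma eq_of_isPendant (h : StrictSunCondition G A) (hy : y ∈ A) (hp : IsPendant G A p y)
    (hq : IsPendant G A q y) : p = q :=
  Finset.singleton_injective (h.eq_of_mem_suns hy hp.singleton_mem_suns hq.singleton_mem_suns)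

end StrictSunCondition

lemma IsCorona.exists_adj_pathCoverable_sdiff_pair (h : IsCorona G D R σ) (hx : x ∈ D) :
    ∃ y ∈ D, G.Adj x y ∧ PathCoverable G (D \ {x, y}) := by
  rcases h.mem_iff.1 hx with hx | ⟨r, hr, rfl⟩
  · exact ⟨σ x, h.mem_leaf hx, h.adj x hx, h.pathCoverable_sdiff_pair hx⟩
  · refine ⟨r, h.mem_base hr, (h.adj r hr).symm, ?_⟩
    exact Finset.pair_comm r (σ r) ▸ h.pathCoverable_sdiff_pair hr

/-- The situation to which the induction in the proof of Kaneko's theorem reduces: `G[A]` is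
connected and satisfies the sun condition, strictly so for nonempty sets, and the theorem holds
for all proper subsets of `A`. -/
structure Reduced (G : SimpleGraph V) (A : Finset V) : Prop where
  connectedOn : ConnectedOn G A
  sunCondition : SunCondition G A
  strict : StrictSunCondition G A
  pathCoverable_of_ssubset : ∀ B ⊂ A, SunCondition G B → PathCoverable G B

end SunComponents

namespace Dangles

variable {V : Type*} [DecidableEq V] {G : SimpleGraph V} {A D E R X : Finset V} {σ : V → V}
  {r x y : V}

lemma mem_suns (h : Dangles G A D x y) (hD : IsSun G D) : D ∈ suns G (A \ {y}) := by
  have := h.right_notMem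
  refine PathFactor.mem_suns.2 ⟨by grind [h.subset], hD, fun u hu w hw huw => ?_⟩
  exact (h.out u hu w (by grind) huw).resolve_right (by grind)

lemma isPendant (h : Dangles G A D x y) (hD : IsCorona G D R σ) (hx : x ∈ R) :
    IsPendant G A (σ x) x := by
  refine ⟨h.subset (hD.mem_leaf hx), (hD.adj x hx).symm, fun w hw hxw => ?_⟩
  rcases h.out _ (hD.mem_leaf hx) w hw hxw with hwD | ⟨hσx, -⟩
  · exact hD.leaf x hx w hwD hxw
  · exact (hD.leaf_ne hx hx hσx).elim

lemma mem_suns_of_mem_suns_insert_sdiff (h : Dangles G A D x y)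
    (hE : E ∈ suns G (insert x (A \ D) \ X)) (hxE : x ∉ E) : E ∈ suns G (A \ X) := by
  obtain ⟨hEA, hsun, hcl⟩ := PathFactor.mem_suns.1 hE
  refine PathFactor.mem_suns.2 ⟨by grind, hsun, fun u hu w hw huw => hcl u hu w ?_ huw⟩
  have := h.out w
  grind [huw.symm]

lemma card_suns_insert_sdiff_le (h : Dangles G A D x y) :
    #(suns G (insert x (A \ D) \ X)) ≤ #(suns G (A \ X)) + 1 := by
  rw [← Finset.card_filter_add_card_filter_not (x ∈ ·), add_comm]
  refine add_le_add (Finset.card_le_card fun E hE => ?_) (card_suns_filter_mem_le_one _ _ x)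
  rw [Finset.mem_filter] at hE
  exact h.mem_suns_of_mem_suns_insert_sdiff hE.1 hE.2

lemma eq_insert_sdiff_of_closedIn (h : Dangles G A D x y) (hA : ConnectedOn G A)
    (hE : E ⊆ insert x (A \ D)) (hxE : x ∈ E) (hcl : ClosedIn G (insert x (A \ D)) E) :
    E = insert x (A \ D) := by
  have hyE : y ∈ E := hcl x hxE y (by grind [h.right_mem, h.right_notMem]) h.adj
  have hED : E ∪ D = A := by
    refine hA (E ∪ D) (by grind [h.subset, h.subset h.left_mem])
      ⟨x, Finset.mem_union_left _ hxE⟩ fun u hu w hw huw => ?_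
    have := hcl u
    have := h.out u
    grind
  grind

lemma sunCondition_or_isSun_insert_sdiff (h : Dangles G A D x y) (hA : Reduced G A) :
    SunCondition G (insert x (A \ D)) ∨ IsSun G (insert x (A \ D)) := by
  by_cases hsun : ∃ E ∈ suns G (insert x (A \ D)), x ∈ E
  · obtain ⟨E, hE, hxE⟩ := hsun
    obtain ⟨hEA, hsun, hcl⟩ := PathFactor.mem_suns.1 hE
    exact .inr (h.eq_insert_sdiff_of_closedIn hA.connectedOn hEA hxE hcl ▸ hsun)
  · refine .inl fun X hX => ?_
    rcases X.eq_empty_or_nonempty with rfl | hne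
    · suffices suns G (insert x (A \ D)) = ∅ by simp [this]
      refine Finset.eq_empty_of_forall_notMem fun E hE => ?_
      have hEA := h.mem_suns_of_mem_suns_insert_sdiff (X := ∅) (by rwa [Finset.sdiff_empty])
        fun hxE => hsun ⟨E, hE, hxE⟩
      simp [hA.sunCondition.suns_eq_empty] at hEA
    · have hXA : X ⊆ A := by grind [h.subset h.left_mem]
      have := hA.strict X hXA hne
      have := h.card_suns_insert_sdiff_le (X := X)
      lia

lemma pathCoverable_of_isSun_insert_sdiff (h : Dangles G A D x y) (hD : HangsAt G 2 D x)
    (hsun : IsSun G (insert x (A \ D))) : PathCoverable G A := by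
  have hyA := h.right_mem
  have hyD := h.right_notMem
  rcases hsun.2 with ⟨v, hv⟩ | ⟨R, σ, hR⟩
  · have hx : x = v := Finset.mem_singleton.1 (hv ▸ Finset.mem_insert_self x _)
    have hy : y = v := Finset.mem_singleton.1 (hv ▸ by grind)
    exact (h.adj.ne (hx.trans hy.symm)).elim
  obtain ⟨z, hz, hxz, hrest⟩ := hR.exists_adj_pathCoverable_sdiff_pair (Finset.mem_insert_self x _)
  obtain rfl : z = y := by grind [h.out x h.left_mem z, hxz.ne]
  refine ((hD.insert hxz.symm hyD).pathCoverable le_rfl).of_sdiff ?_ (by grind [h.subset])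
  convert hrest using 1
  grind [h.left_mem]

lemma pathCoverable_of_leaf (h : Dangles G A D (σ r) y) (hA : Reduced G A)
    (hD : IsCorona G D R σ) (hr : r ∈ R) (hR : R ≠ {r}) : PathCoverable G A := by
  rcases h.sunCondition_or_isSun_insert_sdiff hA with hcond | hsun
  · have hrD := hD.mem_base hr
    have hne := hD.leaf_ne hr hr
    have hss : insert (σ r) (A \ D) ⊂ A := (Finset.ssubset_iff_of_subset
      (by grind [h.subset h.left_mem])).2 ⟨r, h.subset hrD, by grind⟩
    refine (hA.pathCoverable_of_ssubset _ hss hcond).of_sdiff ?_ hss.subset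
    convert hD.pathCoverable_erase_leaf hr hR using 1
    grind [h.subset]
  · exact h.pathCoverable_of_isSun_insert_sdiff (hD.hangsAt h.left_mem) hsun

lemma pathCoverable_or_exists_isPendant (h : Dangles G A D x y) (hA : Reduced G A) (hD : IsSun G D)
    (hx : HasTwoNeighbors G A x) : PathCoverable G A ∨ ∃ p, IsPendant G A p x := by
  rcases hD.2 with ⟨v, rfl⟩ | ⟨R, σ, hR⟩
  · obtain rfl := Finset.mem_singleton.1 h.left_mem
    obtain ⟨w, hw, hwy, hxw⟩ := hx y
    grind [h.out x h.left_mem w hw hxw, hxw.ne]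
  · rcases hR.exists_mem_base_or_leaf h.left_mem with
      ⟨R, σ, hR, hxR⟩ | ⟨R, σ, hR, r, hr, rfl, hne⟩
    · exact .inr ⟨σ x, h.isPendant hR hxR⟩
    · exact .inl (h.pathCoverable_of_leaf hA hR hr hne)

end Dangles

namespace Dangles

variable {V : Type*} [DecidableEq V] {G : SimpleGraph V} {A D E S : Finset V} {x y : V}

lemma pathCoverable_or_exists_isPendant_of_sdiff (h : Dangles G (A \ S) D x y) (hA : Reduced G A)
    (hD : IsSun G D) (hEA : E ⊆ A) (hDE : Disjoint D E) (hE : HangsAt G 1 E y)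
    (hS : ∀ s ∈ S, HangsAt G 2 (A \ (D ∪ E)) s) (hx : HasTwoNeighbors G A x) :
    PathCoverable G A ∨ ∃ p, IsPendant G A p x := by
  have hDA := h.subset.trans Finset.sdiff_subset
  have hunion : D ∪ E ∪ A \ (D ∪ E) = A :=
    Finset.union_sdiff_of_subset (Finset.union_subset hDA hEA)
  have hDF : Disjoint D (A \ (D ∪ E)) := by grind [Finset.disjoint_left]
  have hEF : Disjoint E (A \ (D ∪ E)) := by grind [Finset.disjoint_left]
  rcases hD.2 with ⟨v, rfl⟩ | ⟨R, σ, hR⟩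
  · obtain rfl := Finset.mem_singleton.1 h.left_mem
    obtain ⟨w, hw, hwy, hxw⟩ := hx y
    have hwS : w ∈ S := by grind [h.out x h.left_mem w, hxw.ne]
    have hxE := hE.insert h.adj (Finset.disjoint_singleton_left.1 hDE)
    rw [← Finset.singleton_union] at hxE
    exact .inl (hunion ▸ hxE.pathCoverable_union (hS w hwS) hxw Finset.disjoint_sdiff (by lia))
  rcases hR.exists_mem_base_or_leaf h.left_mem with ⟨R, σ, hR, hxR⟩ | ⟨R, σ, hR, r, hr, rfl, hne⟩
  · by_cases hadj : ∃ s ∈ S, G.Adj (σ x) s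
    · obtain ⟨s, hs, hxs⟩ := hadj
      exact .inl (hunion ▸ hR.pathCoverable_union_of_adj_base_leaf hxR hxR h.adj hxs hE
        ((hS s hs).of_le one_le_two) hDE hDF hEF)
    · have hp := h.isPendant hR hxR
      exact .inr ⟨σ x, hDA (hR.mem_leaf hxR), hp.2.1, fun w hw hxw => hp.2.2 w (by grind) hxw⟩
  · by_cases hadj : ∃ v ∈ D, ∃ s ∈ S, G.Adj v s
    · obtain ⟨v, hv, s, hs, hvs⟩ := hadj
      exact .inl (hunion ▸ hR.pathCoverable_union_of_adj_leaf hr hne hv h.adj hvs hE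
        ((hS s hs).of_le one_le_two) hDE hDF hEF)
    · have hdangles : Dangles G A D (σ r) y :=
        ⟨hDA, h.left_mem, Finset.sdiff_subset h.right_mem, h.right_notMem, h.adj,
          fun u hu w hw huw => h.out u hu w (by grind) huw⟩
      exact .inl (hdangles.pathCoverable_of_leaf hA hR hr hne)

end Dangles

section DeleteEdge

variable {V : Type*} [DecidableEq V] {G : SimpleGraph V} {A D E R S : Finset V} {σ : V → V}
  {x y : V}

lemma card_suns_le_card_filter_notMem_add_two (G : SimpleGraph V) (A : Finset V) (x y : V) :
    #(suns G A) ≤ #{D ∈ suns G A | x ∉ D ∧ y ∉ D} + 2 := by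
  have hsub : suns G A ⊆ ({D ∈ suns G A | x ∉ D ∧ y ∉ D} ∪ {D ∈ suns G A | x ∈ D}) ∪
      {D ∈ suns G A | y ∈ D} := by grind
  have := Finset.card_le_card hsub
  have := Finset.card_union_le ({D ∈ suns G A | x ∉ D ∧ y ∉ D} ∪ {D ∈ suns G A | x ∈ D})
    {D ∈ suns G A | y ∈ D}
  have := Finset.card_union_le {D ∈ suns G A | x ∉ D ∧ y ∉ D} {D ∈ suns G A | x ∈ D}
  have := card_suns_filter_mem_le_one G A x
  have := card_suns_filter_mem_le_one G A y
  lia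

lemma exists_disjoint_suns_of_card_filter_notMem_lt
    (h : #{D ∈ suns G A | x ∉ D ∧ y ∉ D} + 1 < #(suns G A)) :
    ∃ D ∈ suns G A, ∃ E ∈ suns G A, x ∈ D ∧ y ∈ E ∧ Disjoint D E := by
  rw [← Finset.card_filter_add_card_filter_not (s := suns G A) (fun D => x ∉ D ∧ y ∉ D),
    add_lt_add_iff_left, Finset.one_lt_card] at h
  simp only [Finset.mem_filter, not_and_or, not_not] at h
  obtain ⟨D, ⟨hD, hxyD⟩, E, ⟨hE, hxyE⟩, hDE⟩ := h
  have hdisj := pairwiseDisjoint_suns G A hD hE hDE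
  rcases hxyD with hxD | hyD <;> rcases hxyE with hxE | hyE
  · exact (hDE (eq_of_mem_suns hD hE hxD hxE)).elim
  · exact ⟨D, hD, E, hE, hxD, hyE, hdisj⟩
  · exact ⟨E, hE, D, hD, hxE, hyD, hdisj.symm⟩
  · exact (hDE (eq_of_mem_suns hD hE hyD hyE)).elim

lemma IsCorona.pathCoverable_or_isCorona_of_deleteEdges
    (h : IsCorona (G.deleteEdges {s(x, y)}) D R σ) (hx : x ∈ D) (hy : y ∈ D) (hxy : G.Adj x y) :
    PathCoverable G D ∨ IsCorona G D R σ := by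
  have hle : G.deleteEdges {s(x, y)} ≤ G := deleteEdges_le _
  rcases h.mem_iff.1 hx with hxR | ⟨r, hr, rfl⟩
  · rcases h.mem_iff.1 hy with hyR | ⟨r, hr, rfl⟩
    · refine .inr { h with
        adj := fun r hr => hle (h.adj r hr)
        leaf := fun r hr z hz hrz => h.leaf r hr z hz ?_
        critical := fun r hr => (h.critical r hr).congr fun _ _ _ _ huv => hle huv }
      simp only [deleteEdges_adj, Set.mem_singleton_iff, Sym2.eq_iff]
      grind [h.leaf_ne hr hxR, h.leaf_ne hr hyR]
    · refine .inl (h.pathCoverable_of_extra_adj hle hr hx ?_ hxy.symm)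
      rintro rfl
      simpa using h.adj x hr
  · refine .inl (h.pathCoverable_of_extra_adj hle hr hy ?_ hxy)
    rintro rfl
    simpa using (h.adj y hr).symm

lemma Reduced.pathCoverable_of_isSun_deleteEdges (hA : Reduced G A)
    (h : IsSun (G.deleteEdges {s(x, y)}) A) (hx : x ∈ A) (hy : y ∈ A) (hxy : G.Adj x y) :
    PathCoverable G A := by
  rcases h.2 with ⟨v, rfl⟩ | ⟨R, σ, hR⟩
  · rw [Finset.mem_singleton] at hx hy
    exact (hxy.ne (hx.trans hy.symm)).elim
  · refine (hR.pathCoverable_or_isCorona_of_deleteEdges hx hy hxy).resolve_right fun hR => ?_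
    exact hA.sunCondition.not_isSun ⟨hA.connectedOn, .inr ⟨R, σ, hR⟩⟩

lemma Reduced.alternatives_of_mem_suns_deleteEdges (hA : Reduced G A)
    (hD : D ∈ suns (G.deleteEdges {s(x, y)}) A) (hxA : x ∈ A) (hyA : y ∈ A) (hxy : G.Adj x y)
    (hy : HasTwoNeighbors G A y) :
    PathCoverable G A ∨ (∃ p, IsPendant G A p y) ∨ ∃ D, IsSun G D ∧ Dangles G A D x y := by
  obtain ⟨hDA, hsun, hcl⟩ := mem_suns.1 hD
  by_cases hxD : x ∈ D <;> by_cases hyD : y ∈ D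
  · obtain rfl := hA.connectedOn D hDA ⟨x, hxD⟩ (closedIn_of_closedIn_deleteEdges hcl (by simp [*]))
    exact .inl (hA.pathCoverable_of_isSun_deleteEdges hsun hxD hyD hxy)
  · exact .inr (.inr ⟨D, hsun.congr (deleteEdges_adj_iff_of_notMem hyD),
      dangles_of_closedIn_deleteEdges hcl hDA hxD hyA hyD hxy⟩)
  · rw [Sym2.eq_swap] at hsun hcl
    have hdangles := dangles_of_closedIn_deleteEdges hcl hDA hyD hxA hxD hxy.symm
    have hsun := hsun.congr (deleteEdges_adj_iff_of_notMem hxD)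
    exact (hdangles.pathCoverable_or_exists_isPendant hA hsun hy).imp_right .inl
  · have hD := mem_suns_of_mem_suns_deleteEdges hD hxD hyD
    simp [hA.sunCondition.suns_eq_empty] at hD

lemma Reduced.pathCoverable_or_exists_isPendant_of_lt_card_suns (hA : Reduced G A) (hSA : S ⊆ A)
    (hne : S.Nonempty) (hlt : 2 * #S < #(suns (G.deleteEdges {s(x, y)}) (A \ S)))
    (hxy : G.Adj x y) (hy : HasTwoNeighbors G A y) :
    PathCoverable G A ∨ ∃ p, IsPendant G A p y := by
  set G' := G.deleteEdges {s(x, y)} with hG'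
  set 𝒟 := {D ∈ suns G' (A \ S) | x ∉ D ∧ y ∉ D}
  have h𝒟' {B} (hB : B ∈ 𝒟) : B ∈ suns G' (A \ S) ∧ x ∉ B ∧ y ∉ B := Finset.mem_filter.1 hB
  have h𝒟sub : 𝒟 ⊆ suns G (A \ S) := fun B hB =>
    mem_suns_of_mem_suns_deleteEdges (h𝒟' hB).1 (h𝒟' hB).2.1 (h𝒟' hB).2.2
  have := Finset.card_le_card h𝒟sub
  have := hA.strict S hSA hne
  have : #(suns G' (A \ S)) ≤ #𝒟 + 2 := card_suns_le_card_filter_notMem_add_two G' (A \ S) x y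
  obtain ⟨D, hD, E, hE, hxD, hyE, hDE⟩ :=
    exists_disjoint_suns_of_card_filter_notMem_lt (show #𝒟 + 1 < _ by lia)
  have hyD : y ∉ D := Finset.disjoint_right.1 hDE hyE
  have hxE : x ∉ E := Finset.disjoint_left.1 hDE hxD
  obtain ⟨hDA, hDsun, hDcl⟩ := mem_suns.1 hD
  obtain ⟨hEA, hEsun, hEcl⟩ := mem_suns.1 hE
  have hcl : ClosedIn G (A \ S) (D ∪ E) := by
    refine closedIn_of_closedIn_deleteEdges (x := x) (y := y) ?_ (by simp [*])
    intro u hu w hw huw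
    rw [Finset.mem_union] at hu ⊢
    exact hu.imp (hDcl u · w hw huw) (hEcl u · w hw huw)
  have hdisj (B) (hB : B ∈ 𝒟) : Disjoint B (D ∪ E) := Finset.disjoint_union_right.2
    ⟨pairwiseDisjoint_suns G' _ (h𝒟' hB).1 hD fun h => (h𝒟' hB).2.1 (h ▸ hxD),
      pairwiseDisjoint_suns G' _ (h𝒟' hB).1 hE fun h => (h𝒟' hB).2.2 (h ▸ hyE)⟩
  have hhangs (s) (hs : s ∈ S) : HangsAt G 2 (A \ (E ∪ D)) s := Finset.union_comm D E ▸
    hangsAt_of_strict hA.pathCoverable_of_ssubset hA.sunCondition hA.strict hSA hs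
      (Finset.union_subset hDA hEA) hcl h𝒟sub hdisj (by lia)
  have hDsun := hDsun.congr (deleteEdges_adj_iff_of_notMem hyD)
  rw [hG', Sym2.eq_swap] at hEsun hEcl
  have hEsun := hEsun.congr (deleteEdges_adj_iff_of_notMem hxE)
  have hdangles := dangles_of_closedIn_deleteEdges hEcl hEA hyE (hDA hxD) hxE hxy.symm
  exact hdangles.pathCoverable_or_exists_isPendant_of_sdiff hA hEsun
    (hDA.trans Finset.sdiff_subset) hDE.symm (hDsun.hangsAt hxD) hhangs hy

lemma Reduced.alternatives_of_not_sunCondition_deleteEdges (hA : Reduced G A)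
    (h : ¬ SunCondition (G.deleteEdges {s(x, y)}) A) (hxA : x ∈ A) (hyA : y ∈ A) (hxy : G.Adj x y)
    (hy : HasTwoNeighbors G A y) :
    PathCoverable G A ∨ (∃ p, IsPendant G A p y) ∨ ∃ D, IsSun G D ∧ Dangles G A D x y := by
  simp only [SunCondition, not_forall, not_le] at h
  obtain ⟨S, hSA, hlt⟩ := h
  rcases S.eq_empty_or_nonempty with rfl | hne
  · rw [Finset.sdiff_empty, Finset.card_empty, mul_zero, Finset.card_pos] at hlt
    obtain ⟨D, hD⟩ := hlt
    exact hA.alternatives_of_mem_suns_deleteEdges hD hxA hyA hxy hy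
  · exact (hA.pathCoverable_or_exists_isPendant_of_lt_card_suns hSA hne hlt hxy hy).imp_right .inl

end DeleteEdge

section Kaneko

variable {V : Type*} [DecidableEq V] {G : SimpleGraph V} {A B Q : Finset V} {σ : V → V}
  {p r u v y z : V}

lemma Reduced.pathCoverable_or_exists_isPendant (hA : Reduced G A)
    (hedge : ∀ x ∈ A, G.Adj x y → SunCondition (G.deleteEdges {s(x, y)}) A → PathCoverable G A)
    (hyA : y ∈ A) (hy : HasTwoNeighbors G A y) : PathCoverable G A ∨ ∃ p, IsPendant G A p y := by
  by_contra! ⟨hcover, hpendant⟩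
  have hdangles (x) (hx : x ∈ A) (hyx : G.Adj y x) : ∃ D, IsSun G D ∧ Dangles G A D x y := by
    have hcond := mt (hedge x hx hyx.symm) hcover
    simpa [hcover, hpendant] using
      hA.alternatives_of_not_sunCondition_deleteEdges hcond hx hyA hyx.symm hy
  obtain ⟨w₁, hw₁, -, hyw₁⟩ := hy y
  obtain ⟨w₂, hw₂, hne, hyw₂⟩ := hy w₁
  obtain ⟨D₁, hsun₁, hD₁⟩ := hdangles w₁ hw₁ hyw₁
  obtain ⟨D₂, hsun₂, hD₂⟩ := hdangles w₂ hw₂ hyw₂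
  obtain rfl := hA.strict.eq_of_mem_suns hyA (hD₁.mem_suns hsun₁) (hD₂.mem_suns hsun₂)
  have hout := hD₁.out w₂ hD₂.left_mem y hyA hD₂.adj
  exact hne (hout.resolve_left hD₁.right_notMem).1

lemma isCorona_pair (huv : G.Adj u v) : IsCorona G {u, v} {u} fun _ => v where
  nonempty := Finset.singleton_nonempty u
  eq_union := by simp
  injOn := by simp
  notMem := by simpa using huv.ne'
  adj := by simpa using huv
  leaf := by simp
  critical := by simpa using ⟨id, by simp⟩

lemma exists_isPendant_hasTwoNeighbors (hconn : ConnectedOn G A) (hsun : ¬ IsSun G A) (hz : z ∈ A)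
    (hz' : ¬ HasTwoNeighbors G A z) : ∃ r ∈ A, IsPendant G A z r ∧ HasTwoNeighbors G A r := by
  obtain ⟨u, hu, hzu⟩ : ∃ u ∈ A, G.Adj z u := by
    by_contra! hiso
    have hA : {z} = A := hconn {z} (by simpa using hz) (Finset.singleton_nonempty z)
      fun v hv w hw hvw => (hiso w hw (Finset.mem_singleton.1 hv ▸ hvw)).elim
    exact hsun (hA ▸ isSun_singleton G z)
  have hzleaf := eq_of_not_hasTwoNeighbors hz' hu hzu
  refine ⟨u, hu, ⟨hz, hzu, hzleaf⟩, ?_⟩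
  by_contra hu'
  have huleaf := eq_of_not_hasTwoNeighbors hu' hz hzu.symm
  obtain rfl : {z, u} = A := hconn {z, u} (by grind) (Finset.insert_nonempty z {u})
    (by grind [ClosedIn])
  exact hsun ⟨hconn, .inr ⟨_, _, isCorona_pair hzu⟩⟩

lemma IsPendant.sunCondition_sdiff_pair (h : IsPendant G A p r) (hr : r ∈ A)
    (hA : StrictSunCondition G A) : SunCondition G (A \ {r, p}) := by
  intro X hX
  have hcl : ClosedIn G (A \ {r}) (A \ {r, p}) := by
    intro u hu w hw huw
    have := h.2.2 u
    grind [huw.symm]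
  have hle := card_suns_sdiff_add_card_le (by grind) hcl
    (Finset.singleton_subset_iff.2 h.singleton_mem_suns) (by simp) hX
  have hlt := hA ({r} ∪ X) (by grind) (by simp)
  have := Finset.card_union_le {r} X
  rw [Finset.card_singleton] at *
  lia

lemma Reduced.isCorona_of_isPendant (hA : Reduced G A) (hne : Q.Nonempty)
    (hAQ : A = Q ∪ Q.image σ) (hσ : ∀ r ∈ Q, σ r ∉ Q) (hpendant : ∀ r ∈ Q, IsPendant G A (σ r) r) :
    IsCorona G A Q σ := by
  have hQA : Q ⊆ A := hAQ ▸ Finset.subset_union_left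
  have hinj : Set.InjOn σ Q := fun r hr s hs hrs =>
    (hpendant s hs).2.2 r (hQA hr) (hrs ▸ (hpendant r hr).2.1)
  refine ⟨hne, hAQ, hinj, hσ, fun r hr => (hpendant r hr).2.1.symm,
    fun r hr => (hpendant r hr).2.2, fun r hr => ?_⟩
  have hcover : PathCoverable G (A \ {r, σ r}) :=
    hA.pathCoverable_of_ssubset _
      ((Finset.ssubset_iff_of_subset Finset.sdiff_subset).2 ⟨r, hQA hr, by simp⟩)
      ((hpendant r hr).sunCondition_sdiff_pair (hQA hr) hA.strict)
  have hrest : A \ {r, σ r} = Q.erase r ∪ (Q.erase r).image σ := by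
    have hσr := hσ r hr
    have hinj' (s) (hs : s ∈ Q) (h : σ s = σ r) : s = r := hinj hs hr h
    grind
  rw [hrest] at hcover
  refine hcover.perfectlyMatched (by grind) fun s hs w hw => ?_
  exact (hpendant s (Finset.mem_of_mem_erase hs)).2.2 w (by grind)

lemma Reduced.pathCoverable (hA : Reduced G A) (hne : A.Nonempty)
    (hedge : ∀ x ∈ A, ∀ y ∈ A, G.Adj x y → SunCondition (G.deleteEdges {s(x, y)}) A →
      PathCoverable G A) : PathCoverable G A := by
  classical
  by_contra hcover
  have hpendant (y) (hy : y ∈ A) (hy' : HasTwoNeighbors G A y) : ∃ p, IsPendant G A p y :=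
    (hA.pathCoverable_or_exists_isPendant (fun x hx => hedge x hx y hy) hy hy').resolve_left hcover
  choose! σ hσ using hpendant
  obtain ⟨Q, hQ⟩ : ∃ Q, ∀ {v}, v ∈ Q ↔ v ∈ A ∧ HasTwoNeighbors G A v :=
    ⟨{v ∈ A | HasTwoNeighbors G A v}, Finset.mem_filter⟩
  have hσQ (r) (hr : r ∈ Q) : IsPendant G A (σ r) r := hσ r (hQ.1 hr).1 (hQ.1 hr).2
  have hleaf (z) (hz : z ∈ A) (hzQ : z ∉ Q) : ∃ r ∈ Q, σ r = z := by
    obtain ⟨r, hr, hzr, hr'⟩ := exists_isPendant_hasTwoNeighbors hA.connectedOn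
      hA.sunCondition.not_isSun hz fun h => hzQ (hQ.2 ⟨hz, h⟩)
    exact ⟨r, hQ.2 ⟨hr, hr'⟩, hA.strict.eq_of_isPendant hr (hσ r hr hr') hzr⟩
  have hAQ : A = Q ∪ Q.image σ := by
    refine Finset.Subset.antisymm (fun z hz => ?_)
      (Finset.union_subset (fun _ h => (hQ.1 h).1)
        (Finset.image_subset_iff.2 fun r hr => (hσQ r hr).1))
    by_cases hzQ : z ∈ Q
    · exact Finset.mem_union_left _ hzQ
    · exact Finset.mem_union_right _ (Finset.mem_image.2 (hleaf z hz hzQ))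
  have hnotMem (r) (hr : r ∈ Q) : σ r ∉ Q := fun h => by
    obtain ⟨w, hw, hwr, hadj⟩ := (hQ.1 h).2 r
    exact hwr ((hσQ r hr).2.2 w hw hadj)
  have hQne : Q.Nonempty := by
    obtain ⟨z, hz⟩ := hne
    by_cases hzQ : z ∈ Q
    · exact ⟨z, hzQ⟩
    · exact (hleaf z hz hzQ).imp fun _ => And.left
  have hcorona := hA.isCorona_of_isPendant hQne hAQ hnotMem hσQ
  exact hA.sunCondition.not_isSun ⟨hA.connectedOn, .inr ⟨Q, σ, hcorona⟩⟩

lemma SunCondition.of_closedIn (hA : SunCondition G A) (hBA : B ⊆ A) (hB : ClosedIn G A B) :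
    SunCondition G B := by
  intro X hX
  refine (Finset.card_le_card fun E hE => ?_).trans (hA X (hX.trans hBA))
  obtain ⟨hEB, hsun, hcl⟩ := mem_suns.1 hE
  refine mem_suns.2 ⟨by grind, hsun, fun u hu w hw huw => hcl u hu w ?_ huw⟩
  have := hB u
  grind

lemma SunCondition.pathCoverable_of_not_connectedOn (hA : SunCondition G A)
    (hconn : ¬ ConnectedOn G A) (ih : ∀ B ⊂ A, SunCondition G B → PathCoverable G B) :
    PathCoverable G A := by
  simp only [ConnectedOn, not_forall] at hconn
  obtain ⟨D, hD, hne, hcl, hDA⟩ := hconn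
  have hcl' : ClosedIn G A (A \ D) := by
    intro u hu w hw huw
    have := hcl w
    grind [huw.symm]
  exact (ih D (hD.ssubset_of_ne hDA) (hA.of_closedIn hD hcl)).of_sdiff
    (ih (A \ D) (Finset.sdiff_ssubset hD hne) (hA.of_closedIn Finset.sdiff_subset hcl')) hD

lemma SunCondition.pathCoverable_of_forall_ssubset (hA : SunCondition G A)
    (ih : ∀ B ⊂ A, SunCondition G B → PathCoverable G B)
    (hedge : ∀ x ∈ A, ∀ y ∈ A, G.Adj x y → SunCondition (G.deleteEdges {s(x, y)}) A →
      PathCoverable G A) : PathCoverable G A := by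
  rcases A.eq_empty_or_nonempty with rfl | hne
  · exact .empty
  by_cases hconn : ConnectedOn G A
  swap
  · exact hA.pathCoverable_of_not_connectedOn hconn ih
  by_cases hstrict : StrictSunCondition G A
  · exact Reduced.pathCoverable ⟨hconn, hA, hstrict, ih⟩ hne hedge
  · simp only [StrictSunCondition, not_forall, not_lt] at hstrict
    obtain ⟨S, hS, hSne, hle⟩ := hstrict
    exact pathCoverable_of_tight ih hA hS hSne ((hA S hS).antisymm hle)

/-- Kaneko's theorem: the sun condition suffices for a `P_{≥3}`-factor. -/
theorem SunCondition.pathCoverable (hA : SunCondition G A) : PathCoverable G A := by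
  classical
  induction A using Finset.strongInduction generalizing G with
  | H A ih =>
    induction hm : #{e ∈ A ×ˢ A | G.Adj e.1 e.2} using Nat.strong_induction_on generalizing G with
    | h m ihm =>
      refine hA.pathCoverable_of_forall_ssubset (fun B hB hB' => ih B hB hB') ?_
      intro x hx y hy hxy hcond
      refine (ihm _ ?_ hcond rfl).mono (G.deleteEdges_le _)
      rw [← hm]
      refine Finset.card_lt_card (Finset.ssubset_iff_subset_ne.2 ⟨?_, fun h => ?_⟩)
      · intro e he
        simp only [Finset.mem_filter] at he ⊢
        exact he.imp_right fun h => G.deleteEdges_le _ h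
      · have : (x, y) ∈ {e ∈ A ×ˢ A | G.Adj e.1 e.2} := by simp [hx, hy, hxy]
        simp [← h] at this

end Kaneko

/-! ### Isolated toughness -/

section Isolates

variable {V : Type*} {G : SimpleGraph V} {I J Y : Finset V} {a b : V}

/-- The vertices of `I` survive the deletion of `Y` and become isolated by it. -/
structure Isolates (G : SimpleGraph V) (Y I : Finset V) : Prop where
  disjoint : Disjoint I Y
  adj_mem : ∀ u ∈ I, ∀ w, G.Adj u w → w ∈ Y

namespace Isolates

lemma mono (h : Isolates G Y I) (hJ : J ⊆ I) : Isolates G Y J :=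
  ⟨h.disjoint.mono_left hJ, fun u hu => h.adj_mem u (hJ hu)⟩

lemma insert_erase [DecidableEq V] (h : Isolates G Y I) (b : V) :
    Isolates G (insert b Y) (I.erase b) where
  disjoint := by grind [Finset.disjoint_left, h.disjoint]
  adj_mem u hu w huw := Finset.mem_insert_of_mem (h.adj_mem u (Finset.mem_of_mem_erase hu) w huw)

lemma of_deleteEdges (h : Isolates (G.deleteEdges {s(a, b)}) Y I) (ha : a ∈ I → b ∈ Y)
    (hb : b ∈ I → a ∈ Y) : Isolates G Y I where
  disjoint := h.disjoint
  adj_mem u hu w huw := by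
    by_cases hedge : s(u, w) = s(a, b)
    · rw [Sym2.eq_iff] at hedge
      grind
    · exact h.adj_mem u hu w (deleteEdges_adj.2 ⟨huw, hedge⟩)

lemma exists_of_deleteEdges [DecidableEq V] (h : Isolates (G.deleteEdges {s(a, b)}) Y I)
    (hab : a ≠ b) :
    ∃ Y' I', Isolates G Y' I' ∧ #I ≤ #I' + 1 ∧ #Y' + #I ≤ #Y + #I' + #(I ∩ {a, b}) := by
  have hcard := Finset.card_sdiff_add_card_inter I {a, b}
  by_cases hboth : a ∈ I ∧ b ∈ I
  · have hinter : I ∩ {a, b} = {a, b} := by grind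
    rw [hinter, Finset.card_pair hab]
    have := Finset.card_erase_add_one hboth.2
    have := Finset.card_insert_le b Y
    exact ⟨insert b Y, I.erase b, (h.insert_erase b).of_deleteEdges (by simp) (by simp),
      by lia, by lia⟩
  · have hinter : #(I ∩ {a, b}) ≤ 1 := Finset.card_le_one.2 (by grind)
    exact ⟨Y, I \ {a, b}, (h.mono Finset.sdiff_subset).of_deleteEdges (by simp) (by simp),
      by lia, by lia⟩

variable [Finite V]

lemma card_le_numIsolated (h : Isolates G Y I) : #I ≤ numIsolated (G.induce (Y : Set V)ᶜ) := by
  rw [numIsolated, ← Set.ncard_image_of_injective _ Subtype.val_injective, ← Set.ncard_coe_finset]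
  refine Set.ncard_le_ncard (fun v hv => ?_) (Set.toFinite _)
  have hvY : v ∉ Y := Finset.disjoint_left.1 h.disjoint hv
  exact ⟨⟨v, by simpa using hvY⟩, fun w hw => w.2 (h.adj_mem v hv w hw), rfl⟩

lemma isolatedToughness_le (h : Isolates G Y I) (hI : 2 ≤ #I) :
    isolatedToughness G ≤ ((#Y / #I : ℝ) : EReal) := by
  have hne : G ≠ ⊤ := by
    rintro rfl
    obtain ⟨u, hu, w, hw, huw⟩ := Finset.one_lt_card.1 hI
    exact Finset.disjoint_left.1 h.disjoint hw (h.adj_mem u hu w huw)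
  rw [isolatedToughness, if_neg hne]
  refine iInf₂_le_of_le (Y : Set V) (hI.trans h.card_le_numIsolated) ?_
  rw [EReal.coe_le_coe_iff, Set.ncard_coe_finset]
  exact div_le_div_of_nonneg_left (by positivity) (by exact_mod_cast zero_lt_two.trans_le hI)
    (by exact_mod_cast h.card_le_numIsolated)

lemma isolatedToughness_le_of_card {n r x : ℕ} (h : Isolates G Y I) (hx : r + 2 ≤ x)
    (hI : 2 * x ≤ #I) (hY : #Y ≤ n + x + #I) :
    isolatedToughness G ≤ (((n + 3 * (r + 2)) / (2 * (r + 2)) : ℝ) : EReal) := by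
  refine (h.isolatedToughness_le (by lia)).trans (EReal.coe_le_coe_iff.2 ?_)
  have hI₀ : (0 : ℝ) < #I := by exact_mod_cast (by lia : 0 < #I)
  rw [div_le_div_iff₀ hI₀ (by positivity)]
  have hrI : 2 * (r + 2) ≤ #I := by lia
  have : #Y * (2 * (r + 2)) ≤ (n + 3 * (r + 2)) * #I := by
    calc #Y * (2 * (r + 2)) ≤ (n + x + #I) * (2 * (r + 2)) := by gcongr
      _ = n * (2 * (r + 2)) + 2 * x * (r + 2) + 2 * (r + 2) * #I := by ring
      _ ≤ n * #I + #I * (r + 2) + 2 * (r + 2) * #I := by gcongr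
      _ = (n + 3 * (r + 2)) * #I := by ring
  exact_mod_cast this

end Isolates

end Isolates

section IndependentSets

variable {V : Type*} [DecidableEq V] {G : SimpleGraph V} {A B D I R : Finset V} {σ : V → V}
  {a b : V}

lemma IsCorona.card (h : IsCorona G D R σ) : #D = 2 * #R := by
  have hdisj : Disjoint R (R.image σ) := by
    rw [Finset.disjoint_right, Finset.forall_mem_image]
    exact h.notMem
  rw [h.eq_union, Finset.card_union_of_disjoint hdisj, Finset.card_image_of_injOn h.injOn, two_mul]

lemma IsCorona.exists_isIndepSet_notMem (h : IsCorona G D R σ) (a : V) :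
    ∃ I ⊆ D, G.IsIndepSet I ∧ #D = 2 * #I ∧ a ∉ I := by
  -- All leaves, except that `a`, if it is a leaf, is replaced by its neighbour.
  let τ : V → V := fun r => if σ r = a then r else σ r
  have hinj := h.leaf_inj
  have hleaf := h.leaf
  have hbase := h.mem_base
  have hmem := h.mem_leaf
  have hne := h.leaf_ne
  refine ⟨R.image τ, ?_, ?_, ?_, ?_⟩
  · grind
  · rw [Finset.coe_image]
    rintro _ ⟨r, hr, rfl⟩ _ ⟨s, hs, rfl⟩ hrs hadj
    have := hadj.symm
    grind
  · rw [h.card, Finset.card_image_of_injOn fun r hr s hs hrs => by grind]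
  · grind

lemma IsSun.exists_isIndepSet_notMem (h : IsSun G D) (a : V) :
    ∃ I ⊆ D, G.IsIndepSet I ∧ #D + (if #D = 1 then 1 else 0) = 2 * #I ∧ (a ∈ I → #D = 1) := by
  rcases h.2 with ⟨v, rfl⟩ | ⟨R, σ, hR⟩
  · exact ⟨{v}, subset_rfl, by simp, by simp, by simp⟩
  · obtain ⟨I, hID, hI, hcard, ha⟩ := hR.exists_isIndepSet_notMem a
    exact ⟨I, hID, hI, by rw [if_neg] <;> lia, fun haI => (ha haI).elim⟩

lemma isolates_compl_union_sdiff [Fintype V] (hBA : B ⊆ A) (hB : ClosedIn G A B) (hIB : I ⊆ B)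
    (hI : G.IsIndepSet I) : Isolates G (Aᶜ ∪ B \ I) I where
  disjoint := by
    rw [Finset.disjoint_left]
    grind [Finset.mem_compl]
  adj_mem u hu w huw := by
    have hBw := hB u (hIB hu) w
    have hIw : w ∉ I := fun hw => hI hu hw huw.ne huw
    grind [Finset.mem_compl]

lemma closedIn_biUnion_suns (G : SimpleGraph V) (A : Finset V) :
    ClosedIn G A ((suns G A).biUnion id) := by
  intro u hu w hw huw
  obtain ⟨D, hD, huD⟩ := Finset.mem_biUnion.1 hu
  exact Finset.mem_biUnion.2 ⟨D, hD, (mem_suns.1 hD).2.2 u huD w hw huw⟩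

lemma isIndepSet_biUnion_suns {I : Finset V → Finset V} (hID : ∀ D ∈ suns G A, I D ⊆ D)
    (hI : ∀ D ∈ suns G A, G.IsIndepSet (I D)) : G.IsIndepSet ((suns G A).biUnion I) := by
  intro u hu w hw hne huw
  obtain ⟨D, hD, huD⟩ := Finset.mem_biUnion.1 hu
  obtain ⟨E, hE, hwE⟩ := Finset.mem_biUnion.1 hw
  have hwD := (mem_suns.1 hD).2.2 u (hID D hD huD) w ((mem_suns.1 hE).1 (hID E hE hwE)) huw
  obtain rfl := eq_of_mem_suns hD hE hwD (hID E hE hwE)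
  exact hI D hD huD hwE hne huw

lemma exists_isIndepSet_biUnion_suns (G : SimpleGraph V) (A : Finset V) (a : V) :
    ∃ I ⊆ (suns G A).biUnion id, G.IsIndepSet I ∧ #(suns G A) ≤ #I ∧
      #((suns G A).biUnion id) + #{D ∈ suns G A | #D = 1} = 2 * #I ∧
      (a ∈ I → {a} ∈ suns G A) := by
  choose! I hID hI hcard ha using fun D (hD : D ∈ suns G A) =>
    (mem_suns.1 hD).2.1.exists_isIndepSet_notMem a
  have hdisj : (suns G A : Set (Finset V)).PairwiseDisjoint I := fun D hD E hE hne =>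
    (pairwiseDisjoint_suns G A hD hE hne).mono (hID D hD) (hID E hE)
  refine ⟨(suns G A).biUnion I, Finset.biUnion_mono hID, isIndepSet_biUnion_suns hID hI, ?_, ?_,
    fun haI => ?_⟩
  · rw [Finset.card_biUnion hdisj, Finset.card_eq_sum_ones]
    refine Finset.sum_le_sum fun D hD => ?_
    have := (mem_suns.1 hD).2.1.nonempty.card_pos
    have := hcard D hD
    lia
  · rw [Finset.card_biUnion (pairwiseDisjoint_suns G A), Finset.card_biUnion hdisj,
      Finset.card_filter, ← Finset.sum_add_distrib, Finset.mul_sum]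
    exact Finset.sum_congr rfl hcard
  · obtain ⟨D, hD, haD⟩ := Finset.mem_biUnion.1 haI
    obtain ⟨v, rfl⟩ := Finset.card_eq_one.1 (ha D hD haD)
    rwa [Finset.mem_singleton.1 (hID _ hD haD)]

lemma exists_isolates_suns [Fintype V] (G : SimpleGraph V) (A : Finset V) (a : V) :
    ∃ Y I : Finset V, Isolates G Y I ∧ #(suns G A) ≤ #I ∧
      #Y + #{D ∈ suns G A | #D = 1} ≤ #Aᶜ + #I ∧ I ⊆ (suns G A).biUnion id ∧
      (a ∈ (suns G A).biUnion id → {a} ∉ suns G A → a ∈ Y) := by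
  obtain ⟨I, hIU, hI, hcard, hU, ha⟩ := exists_isIndepSet_biUnion_suns G A a
  have hUA : (suns G A).biUnion id ⊆ A :=
    Finset.biUnion_subset.2 fun D hD => (mem_suns.1 hD).1
  refine ⟨_, I, isolates_compl_union_sdiff hUA (closedIn_biUnion_suns G A) hIU hI, hcard, ?_, hIU,
    by grind⟩
  have := Finset.card_union_le Aᶜ ((suns G A).biUnion id \ I)
  have := Finset.card_sdiff_add_card_eq_card hIU
  lia

lemma exists_isolates_of_suns_deleteEdges [Fintype V] (G : SimpleGraph V) (A : Finset V)
    (hab : a ≠ b) : ∃ Y I : Finset V, Isolates G Y I ∧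
      #(suns (G.deleteEdges {s(a, b)}) A) ≤ #I + 1 ∧ #Y ≤ #Aᶜ + #I := by
  set H := G.deleteEdges {s(a, b)}
  by_cases hlarge : a ∈ (suns H A).biUnion id ∧ {a} ∉ suns H A
  · obtain ⟨Y, I, hYI, hI, hY, -, haY⟩ := exists_isolates_suns H A a
    have haY := haY hlarge.1 hlarge.2
    have haI := Finset.disjoint_right.1 hYI.disjoint haY
    exact ⟨Y, I, hYI.of_deleteEdges (fun h => (haI h).elim) fun _ => haY, by lia, by lia⟩
  obtain ⟨Y, I, hYI, hI, hY, hIU, hbY⟩ := exists_isolates_suns H A b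
  by_cases hb : b ∈ Y
  · have hbI := Finset.disjoint_right.1 hYI.disjoint hb
    exact ⟨Y, I, hYI.of_deleteEdges (fun _ => hb) fun h => (hbI h).elim, by lia, by lia⟩
  obtain ⟨Y', I', hYI', hI', hY'⟩ := hYI.exists_of_deleteEdges hab
  have hsing : (I ∩ {a, b}).image singleton ⊆ {D ∈ suns H A | #D = 1} := by
    rw [Finset.image_subset_iff]
    grind
  have := Finset.card_le_card hsing
  rw [Finset.card_image_of_injective _ Finset.singleton_injective] at this
  exact ⟨Y', I', hYI', by lia, by lia⟩

end IndependentSets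

section Connectivity

variable {V : Type*} {G : SimpleGraph V} {A D S W X : Finset V} {k : ℕ} {a b u v : V}

lemma connectedOn_of_connected_induce (h : (G.induce (A : Set V)).Connected) :
    ConnectedOn G A := by
  rintro D hDA ⟨v, hv⟩ hD
  refine hDA.antisymm fun w hw => ?_
  have hwalk {x y : (A : Set V)} (p : (G.induce (A : Set V)).Walk x y) (hx : x.1 ∈ D) :
      y.1 ∈ D := by
    induction p with
    | nil => exact hx
    | cons hxz _ ih => exact ih (hD _ hx _ (Subtype.prop _) hxz)
  obtain ⟨p⟩ := h.preconnected ⟨v, hDA hv⟩ ⟨w, hw⟩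
  exact hwalk p hv

lemma HasTwoNeighbors.exists_adj_deleteEdges (hv : HasTwoNeighbors G A v) (a b : V) :
    ∃ w ∈ A, (G.deleteEdges {s(a, b)}).Adj v w := by
  classical
  obtain ⟨w, hw, hwab, hvw⟩ := hv (if v = a then b else a)
  refine ⟨w, hw, deleteEdges_adj.2 ⟨hvw, ?_⟩⟩
  rw [Set.mem_singleton_iff, Sym2.eq_iff]
  grind

lemma eq_or_eq_of_hasTwoNeighbors (hv : HasTwoNeighbors G A v)
    (hD : ∀ w ∈ A, (G.deleteEdges {s(a, b)}).Adj v w → w = u) : v = a ∨ v = b := by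
  obtain ⟨w, hw, hwu, hvw⟩ := hv u
  by_contra! hne
  refine hwu (hD w hw (deleteEdges_adj.2 ⟨hvw, ?_⟩))
  rw [Set.mem_singleton_iff, Sym2.eq_iff]
  grind

variable [DecidableEq V]

lemma IsKConnected.connectedOn [Fintype V] (h : IsKConnected k G) (hX : #X < k) :
    ConnectedOn G Xᶜ := by
  refine connectedOn_of_connected_induce ?_
  rw [Finset.coe_compl]
  exact h.2 X (by rwa [Set.ncard_coe_finset])

lemma IsKConnected.hasTwoNeighbors [Fintype V] (h : IsKConnected k G) (hW : #W + 2 ≤ k)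
    (hv : v ∉ W) : HasTwoNeighbors G Wᶜ v := by
  intro u
  by_contra! hu
  have hX : #(W ∪ ({u} : Finset V).erase v) ≤ #W + 1 :=
    (Finset.card_union_le _ _).trans
      (Nat.add_le_add_left (Finset.card_erase_le.trans_eq (Finset.card_singleton u)) _)
  have hsingle := h.connectedOn (hX.trans_lt (by lia)) {v} (by simp [hv]) (by simp) (by
    intro x hx w hw hxw
    obtain rfl := Finset.mem_singleton.1 hx
    have := hu w
    have := hxw.ne
    grind [Finset.mem_compl])
  have hcard := congrArg Finset.card hsingle
  have := h.1
  rw [Finset.card_singleton, Finset.card_compl, ← Nat.card_eq_fintype_card] at hcard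
  lia

lemma ConnectedOn.card_suns_deleteEdges_le_two (h : ConnectedOn G A) (a b : V) :
    #(suns (G.deleteEdges {s(a, b)}) A) ≤ 2 := by
  by_contra! hlt
  have hcard := card_suns_le_card_filter_notMem_add_two (G.deleteEdges {s(a, b)}) A a b
  obtain ⟨D, hD⟩ := Finset.card_pos.1 (Nat.pos_of_lt_add_left (hlt.trans_le hcard))
  obtain ⟨hD, ha, hb⟩ := Finset.mem_filter.1 hD
  obtain ⟨hDA, hsun, hcl⟩ := mem_suns.1 hD
  obtain rfl : D = A :=
    h D hDA hsun.nonempty (closedIn_of_closedIn_deleteEdges hcl (by simp [ha, hb]))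
  obtain ⟨E, hE, hED⟩ := Finset.exists_mem_ne (one_lt_two.trans hlt) D
  obtain ⟨z, hz⟩ := (mem_suns.1 hE).2.1.nonempty
  exact hED (eq_of_mem_suns hE hD hz ((mem_suns.1 hE).1 hz))

lemma suns_deleteEdges_eq_empty (h : ∀ v ∈ A, HasTwoNeighbors G A v) (a b : V) :
    suns (G.deleteEdges {s(a, b)}) A = ∅ := by
  set H := G.deleteEdges {s(a, b)} with hH
  refine Finset.eq_empty_of_forall_notMem fun D hD => ?_
  obtain ⟨hDA, hsun, hcl⟩ := mem_suns.1 hD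
  have hend {v u : V} (hv : v ∈ D) (hu : ∀ w ∈ D, H.Adj v w → w = u) : v = a ∨ v = b :=
    eq_or_eq_of_hasTwoNeighbors (h v (hDA hv)) fun w hw hvw => hu w (hcl v hv w hw hvw) hvw
  rcases hsun.2 with ⟨v, rfl⟩ | ⟨R, σ, hR⟩
  · obtain ⟨w, hw, hvw⟩ := (h v (hDA (Finset.mem_singleton_self v))).exists_adj_deleteEdges a b
    exact hvw.ne (Finset.mem_singleton.1 (hcl v (Finset.mem_singleton_self v) w hw hvw)).symm
  have hσ (r) (hr : r ∈ R) : σ r = a ∨ σ r = b := hend (hR.mem_leaf hr) (hR.leaf r hr)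
  obtain ⟨r, hr⟩ := hR.nonempty
  by_cases hRr : R = {r}
  · subst hRr
    have hr' := hend (hR.mem_base hr) (hR.swap.leaf (σ r) (by simp))
    have hadj := hR.adj r hr
    simp only [hH, deleteEdges_adj, Set.mem_singleton_iff, Sym2.eq_iff] at hadj
    have := hadj.1.ne
    grind
  · obtain ⟨t, ht, htr⟩ := ((Finset.nontrivial_iff_ne_singleton hr).2 hRr).exists_ne r
    obtain ⟨s, hs, hsr, hts, -⟩ := hR.exists_adj_pathCoverable_sdiff hr ht htr
    have := hR.leaf_inj
    have := hts.ne
    grind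

lemma IsKConnected.le_card_of_two_mul_lt_card_suns [Fintype V] {r : ℕ}
    (h : IsKConnected (#W + r + 2) G) (hlt : 2 * #S < #(suns (G.deleteEdges {s(a, b)}) (Wᶜ \ S))) :
    r + 2 ≤ #S := by
  by_contra! hS
  obtain rfl | hne := S.eq_empty_or_nonempty
  · have htwo (v) (hv : v ∈ Wᶜ) : HasTwoNeighbors G Wᶜ v :=
      h.hasTwoNeighbors (by lia) (Finset.mem_compl.1 hv)
    simp [suns_deleteEdges_eq_empty htwo] at hlt
  · have hconn : ConnectedOn G (Wᶜ \ S) := by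
      have := Finset.card_union_le W S
      rw [Finset.sdiff_eq_inter_compl, ← Finset.compl_union]
      exact h.connectedOn (by lia)
    have := hconn.card_suns_deleteEdges_le_two a b
    have := hne.card_pos
    lia

end Connectivity

theorem IsKConnected.isFactorCriticalAvoidable {V : Type*} [Finite V] {G : SimpleGraph V} {n r : ℕ}
    (h : IsKConnected (n + r + 2) G)
    (hI : (((n + 3 * (r + 2)) / (2 * (r + 2)) : ℝ) : EReal) < isolatedToughness G) :
    IsFactorCriticalAvoidable 3 n G := by
  classical
  have := Fintype.ofFinite V
  rintro W rfl e he
  induction e with | _ a b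
  have hab : G.Adj a.1 b.1 := he
  have hsun : SunCondition (G.deleteEdges {s(a.1, b.1)}) Wᶜ := by
    intro S _
    by_contra! hlt
    have hr := h.le_card_of_two_mul_lt_card_suns hlt
    obtain ⟨Y, I, hYI, hcard, hY⟩ := exists_isolates_of_suns_deleteEdges G (Wᶜ \ S) hab.ne
    have : #(Wᶜ \ S)ᶜ ≤ #W + #S := by
      rw [Finset.sdiff_eq_inter_compl, ← Finset.compl_union, compl_compl]
      exact Finset.card_union_le W S
    exact hI.not_ge (hYI.isolatedToughness_le_of_card hr (by lia) (by lia))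
  obtain ⟨F, hF, hpath⟩ := hsun.pathCoverable.exists_isPathFactor
  rw [Finset.coe_compl] at hpath
  refine ⟨F.induce (W : Set V)ᶜ, ⟨fun u w huw => ?_, hpath.2⟩, fun hmem => ?_⟩
  · exact G.deleteEdges_le _ (hF huw)
  · have := hF (show F.Adj a b from hmem)
    simp at this

/-! ### The joins `K_a + m K₂` -/

section Obstruction

variable {V : Type*} {G F : SimpleGraph V} {k : ℕ} {S P : Finset V}

lemma IsPathFactor.card_le_two_mul_card (h : IsPathFactor k G F)
    (hP : ∀ p ∈ P, ∃ s ∈ S, F.Adj s p) : #P ≤ 2 * #S := by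
  classical
  choose! f hfS hf using hP
  refine Finset.card_le_mul_card_image_of_maps_to hfS 2 fun s _ => ?_
  by_contra! hfiber
  obtain ⟨x, y, z, hx, hy, hz, hxy, hxz, hyz⟩ := Finset.two_lt_card_iff.1 hfiber
  simp only [Finset.mem_filter] at hx hy hz
  have := h.eq_of_adj (hx.2 ▸ hf x hx.1) (hy.2 ▸ hf y hy.1) (hz.2 ▸ hf z hz.1)
  grind

lemma IsPathFactor.card_lt_two_mul_card {ι : Type*} [Fintype ι] {x y : ι → V} {i₀ : ι}
    (h : IsPathFactor 3 G F) (hinj : Function.Injective (Sum.elim x y))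
    (hx : ∀ i z, G.Adj (x i) z → z ∈ S ∨ z = y i) (hy : ∀ i z, G.Adj (y i) z → z ∈ S ∨ z = x i)
    (hi₀ : ¬ F.Adj (x i₀) (y i₀)) : Fintype.card ι < 2 * #S := by
  classical
  have hpair (i : ι) : ∃ p, (p = x i ∨ p = y i) ∧ ∃ s ∈ S, F.Adj s p := by
    obtain ⟨z, hzx, hzy, hz⟩ := h.exists_adj_ne (x i) (y i)
    rcases hz with hz | hz
    · exact ⟨x i, .inl rfl, z, (hx i z (h.1 hz)).resolve_right hzy, hz.symm⟩
    · exact ⟨y i, .inr rfl, z, (hy i z (h.1 hz)).resolve_right hzx, hz.symm⟩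
  have hx₀ : ∃ s ∈ S, F.Adj s (x i₀) := by
    obtain ⟨z, -, -, hz⟩ := h.exists_adj_ne (x i₀) (x i₀)
    rw [or_self] at hz
    exact ⟨z, (hx i₀ z (h.1 hz)).resolve_right fun hzy => hi₀ (hzy ▸ hz), hz.symm⟩
  have hy₀ : ∃ s ∈ S, F.Adj s (y i₀) := by
    obtain ⟨z, -, -, hz⟩ := h.exists_adj_ne (y i₀) (y i₀)
    rw [or_self] at hz
    exact ⟨z, (hy i₀ z (h.1 hz)).resolve_right fun hzx => hi₀ (hzx ▸ hz.symm), hz.symm⟩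
  choose p hp hpS using hpair
  have hxy := Sum.elim_injective.1 hinj
  have hpinj : Function.Injective p := fun i j hij => by grind
  have hdisj : Disjoint {x i₀, y i₀} ((Finset.univ.erase i₀).image p) := by
    grind [Finset.disjoint_right]
  have hcard : #({x i₀, y i₀} ∪ (Finset.univ.erase i₀).image p) ≤ 2 * #S := by
    refine h.card_le_two_mul_card fun q hq => ?_
    simp only [Finset.mem_union, Finset.mem_insert, Finset.mem_singleton, Finset.mem_image] at hq
    obtain (rfl | rfl) | ⟨i, -, rfl⟩ := hq
    exacts [hx₀, hy₀, hpS i]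
  rw [Finset.card_union_of_disjoint hdisj, Finset.card_pair (hxy.2.2 i₀ i₀),
    Finset.card_image_of_injective _ hpinj] at hcard
  have := Finset.card_erase_add_one (Finset.mem_univ i₀)
  rw [Finset.card_univ] at this
  lia

lemma not_isFactorCriticalAvoidable {ι : Type*} [Fintype ι] {x y : ι → V} {i₀ : ι} {W : Finset V}
    (hinj : Function.Injective (Sum.elim x y)) (hxy : G.Adj (x i₀) (y i₀))
    (hxW : ∀ i, x i ∉ W) (hyW : ∀ i, y i ∉ W)
    (hx : ∀ i z, G.Adj (x i) z → z ∈ W ∨ z ∈ S ∨ z = y i)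
    (hy : ∀ i z, G.Adj (y i) z → z ∈ W ∨ z ∈ S ∨ z = x i) (hS : 2 * #S ≤ Fintype.card ι) :
    ¬ IsFactorCriticalAvoidable 3 #W G := by
  classical
  intro h
  let x' (i : ι) : ↥(W : Set V)ᶜ := ⟨x i, hxW i⟩
  let y' (i : ι) : ↥(W : Set V)ᶜ := ⟨y i, hyW i⟩
  let S' : Finset ↥(W : Set V)ᶜ := S.subtype (· ∈ (W : Set V)ᶜ)
  have hS' : #S' ≤ #S := by simpa [S', Finset.card_subtype] using Finset.card_filter_le _ _
  have hinj' : Function.Injective (Sum.elim x' y') := by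
    refine .of_comp (f := Subtype.val) ?_
    rwa [Sum.comp_elim]
  have hx' (i : ι) (z) (hz : (G.induce (W : Set V)ᶜ).Adj (x' i) z) : z ∈ S' ∨ z = y' i := by
    simpa [S', y', Subtype.ext_iff] using (hx i z hz).resolve_left z.2
  have hy' (i : ι) (z) (hz : (G.induce (W : Set V)ᶜ).Adj (y' i) z) : z ∈ S' ∨ z = x' i := by
    simpa [S', x', Subtype.ext_iff] using (hy i z hz).resolve_left z.2
  obtain ⟨F, hF, hedge⟩ := h W rfl s(x' i₀, y' i₀) hxy
  exact (hF.card_lt_two_mul_card hinj' hx' hy' hedge).not_ge (by lia)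

end Obstruction

section Toughness

variable {V : Type*} [Finite V] {G : SimpleGraph V}

lemma exists_isolates_card_eq_numIsolated (G : SimpleGraph V) (X : Set V) :
    ∃ Y I : Finset V, Isolates G Y I ∧ #Y = X.ncard ∧ #I = numIsolated (G.induce Xᶜ) := by
  have hI := Set.toFinite (Subtype.val '' {v | (G.induce Xᶜ).IsIsolated v})
  refine ⟨X.toFinite.toFinset, hI.toFinset, ⟨Finset.disjoint_left.2 ?_, ?_⟩, ?_, ?_⟩
  · simp only [Set.Finite.mem_toFinset]
    rintro _ ⟨v, -, rfl⟩
    exact v.2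
  · simp only [Set.Finite.mem_toFinset]
    rintro _ ⟨v, hv, rfl⟩ w hvw
    by_contra hw
    exact hv ⟨w, hw⟩ hvw
  · rw [Set.ncard_eq_toFinset_card X]
  · rw [← Set.ncard_eq_toFinset_card, Set.ncard_image_of_injective _ Subtype.val_injective]
    rfl

lemma le_isolatedToughness {c : ℝ} (h : ∀ Y I, Isolates G Y I → 2 ≤ #I → c ≤ #Y / #I) :
    c ≤ isolatedToughness G := by
  unfold isolatedToughness
  split_ifs
  · exact le_top
  refine le_iInf₂ fun X hX => EReal.coe_le_coe_iff.2 ?_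
  obtain ⟨Y, I, hYI, hY, hI⟩ := exists_isolates_card_eq_numIsolated G X
  rw [← hY, ← hI]
  exact h Y I hYI (hI ▸ hX)

end Toughness

section CompleteJoin

variable {a m : ℕ} {u v : Fin a} {p q : Fin m × Fin 2}

@[simp]
lemma completeJoinK2_adj_inl_inl : (completeJoinK2 a m).Adj (.inl u) (.inl v) ↔ u ≠ v := Iff.rfl

@[simp]
lemma completeJoinK2_adj_inl_inr : (completeJoinK2 a m).Adj (.inl u) (.inr p) := trivial

@[simp]
lemma completeJoinK2_adj_inr_inr :
    (completeJoinK2 a m).Adj (.inr p) (.inr q) ↔ p.1 = q.1 ∧ p.2 ≠ q.2 := by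
  change (copiesK2 m).Adj p q ↔ _
  simp [copiesK2, boxProd_adj, and_comm]

lemma completeJoinK2_adj_inl {z : Fin a ⊕ Fin m × Fin 2} (hz : z ≠ .inl u) :
    (completeJoinK2 a m).Adj (.inl u) z := by
  cases z with
  | inl v => simpa [eq_comm] using hz
  | inr p => exact completeJoinK2_adj_inl_inr

lemma isKConnected_completeJoinK2 (a : ℕ) (hm : 0 < m) : IsKConnected a (completeJoinK2 a m) := by
  refine ⟨by simpa using hm, fun X hX => ?_⟩
  obtain ⟨_, ⟨u, rfl⟩, hu⟩ : ∃ z ∈ Set.range (Sum.inl : Fin a → Fin a ⊕ Fin m × Fin 2), z ∉ X :=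
    Set.exists_mem_notMem_of_ncard_lt_ncard (by
      rwa [← Set.image_univ, Set.ncard_image_of_injective _ Sum.inl_injective, Set.ncard_univ,
        Nat.card_fin])
  refine connected_iff_exists_forall_reachable _ |>.2 ⟨⟨_, hu⟩, fun w => ?_⟩
  obtain rfl | hw := eq_or_ne w ⟨_, hu⟩
  · rfl
  · exact Adj.reachable (completeJoinK2_adj_inl fun hwu => hw (Subtype.ext hwu) :
      (completeJoinK2 a m).Adj (.inl u) w.1)

lemma Isolates.add_card_le_card {Y I : Finset (Fin a ⊕ Fin m × Fin 2)}
    (h : Isolates (completeJoinK2 a m) Y I) (hI : 2 ≤ #I) : a + #I ≤ #Y := by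
  have hinl (u : Fin a) : .inl u ∈ Y := by
    obtain ⟨z, hz, hzu⟩ := Finset.exists_mem_ne hI (.inl u)
    exact h.adj_mem z hz _ (completeJoinK2_adj_inl hzu).symm
  have hleft : I.toLeft = ∅ := Finset.eq_empty_of_forall_notMem fun u hu =>
    Finset.disjoint_left.1 h.disjoint (Finset.mem_toLeft.1 hu) (hinl u)
  have hright : #I.toRight = #I := by
    simpa [hleft] using Finset.card_toLeft_add_card_toRight (u := I)
  let mate : Fin m × Fin 2 → Fin m × Fin 2 := Prod.map id (· + 1)
  have hmate : Function.Injective mate := Function.injective_id.prodMap (add_left_injective 1)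
  have hsub : Finset.univ.disjSum (I.toRight.image mate) ⊆ Y := by
    rintro (u | q) hq
    · exact hinl u
    · obtain ⟨p, hp, rfl⟩ := Finset.mem_image.1 (Finset.inr_mem_disjSum.1 hq)
      exact h.adj_mem _ (Finset.mem_toRight.1 hp) _ (completeJoinK2_adj_inr_inr.2 (by simp [mate]))
  calc a + #I = #((Finset.univ : Finset (Fin a)).disjSum (I.toRight.image mate)) := by
        rw [Finset.card_disjSum, Finset.card_univ, Fintype.card_fin,
          Finset.card_image_of_injective _ hmate, hright]
    _ ≤ #Y := Finset.card_le_card hsub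

lemma Isolates.card_le_of_completeJoinK2 {Y I : Finset (Fin a ⊕ Fin m × Fin 2)}
    (h : Isolates (completeJoinK2 a m) Y I) (hI : 2 ≤ #I) : #I ≤ m := by
  have hle := h.add_card_le_card hI
  have := Finset.card_le_univ (I ∪ Y)
  rw [Finset.card_union_of_disjoint h.disjoint] at this
  simp only [Fintype.card_sum, Fintype.card_prod, Fintype.card_fin] at this
  lia

lemma isolates_completeJoinK2 (a m : ℕ) : Isolates (completeJoinK2 a m)
    (Finset.univ.disjSum (Finset.univ ×ˢ {1})) (Finset.disjSum ∅ (Finset.univ ×ˢ {0})) where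
  disjoint := by
    rw [Finset.disjoint_left]
    rintro (u | ⟨j, c⟩) <;> simp
    lia
  adj_mem := by
    rintro (u | ⟨j, c⟩) hu (w | ⟨k, d⟩) hadj
    · simp at hu
    · simp at hu
    · simp
    · simp only [Finset.inr_mem_disjSum, Finset.mem_product, Finset.mem_univ, true_and,
        Finset.mem_singleton, completeJoinK2_adj_inr_inr] at hu hadj ⊢
      lia

lemma isolatedToughness_completeJoinK2 (a : ℕ) (hm : 2 ≤ m) :
    isolatedToughness (completeJoinK2 a m) = (((a + m) / m : ℝ) : EReal) := by
  refine le_antisymm ?_ (le_isolatedToughness fun Y I h hI => ?_)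
  · simpa using (isolates_completeJoinK2 a m).isolatedToughness_le (by simpa using hm)
  · have hIm := h.card_le_of_completeJoinK2 hI
    have hIY := h.add_card_le_card hI
    rw [div_le_div_iff₀ (by exact_mod_cast (by lia)) (by exact_mod_cast (by lia))]
    have : (a + m) * #I ≤ #Y * m := by
      calc (a + m) * #I = a * #I + #I * m := by ring
        _ ≤ a * m + #I * m := by gcongr
        _ = (a + #I) * m := by ring
        _ ≤ #Y * m := by gcongr
    exact_mod_cast this

lemma not_isFactorCriticalAvoidable_completeJoinK2 (n : ℕ) {s : ℕ} (hs : 0 < s) :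
    ¬ IsFactorCriticalAvoidable 3 n (completeJoinK2 (n + s) (2 * s)) := by
  let W : Finset (Fin (n + s) ⊕ Fin (2 * s) × Fin 2) :=
    Finset.univ.map ((Fin.castAddEmb s).trans .inl)
  let S : Finset (Fin (n + s) ⊕ Fin (2 * s) × Fin 2) :=
    Finset.univ.map ((Fin.natAddEmb n).trans .inl)
  have hadj (i : Fin (2 * s)) (c d : Fin 2) (hcd : c ≠ d) (z)
      (hz : (completeJoinK2 (n + s) (2 * s)).Adj (.inr (i, c)) z) :
      z ∈ W ∨ z ∈ S ∨ z = .inr (i, d) := by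
    rcases z with u | ⟨j, e⟩
    · cases u using Fin.addCases <;> simp [W, S]
    · obtain ⟨rfl, hce⟩ := completeJoinK2_adj_inr_inr.1 hz
      simp only [Sum.inr.injEq, Prod.mk.injEq, true_and] at hce ⊢
      lia
  have hW : #W = n := by simp [W]
  suffices ¬ IsFactorCriticalAvoidable 3 #W (completeJoinK2 (n + s) (2 * s)) by rwa [hW] at this
  exact not_isFactorCriticalAvoidable (S := S)
    (x := fun i => .inr (i, 0)) (y := fun i => .inr (i, 1)) (i₀ := ⟨0, by lia⟩)
    (Sum.elim_injective.2 ⟨fun i j hij => by simpa using hij, fun i j hij => by simpa using hij,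
      by simp⟩) (by simp) (by simp [W]) (by simp [W]) (fun i => hadj i 0 1 (by simp))
    (fun i => hadj i 1 0 (by simp)) (by simp [S])

end CompleteJoin

end PathFactor

theorem theorem8 (n r : ℕ) :
    (∀ (V : Type*) [Finite V] (G : SimpleGraph V),
      PathFactor.IsKConnected (n + r + 2) G →
      ((((n : ℝ) + 3 * ((r : ℝ) + 2)) / (2 * ((r : ℝ) + 2)) : ℝ) : EReal)
        < PathFactor.isolatedToughness G →
      PathFactor.IsFactorCriticalAvoidable 3 n G) ∧
    (PathFactor.IsKConnected (n + r + 2) (PathFactor.completeJoinK2 (n + r + 2) (2 * r + 4)) ∧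
      PathFactor.isolatedToughness (PathFactor.completeJoinK2 (n + r + 2) (2 * r + 4))
        = ((((n : ℝ) + 3 * ((r : ℝ) + 2)) / (2 * ((r : ℝ) + 2)) : ℝ) : EReal) ∧
      ¬ PathFactor.IsFactorCriticalAvoidable 3 n
        (PathFactor.completeJoinK2 (n + r + 2) (2 * r + 4))) ∧
    (1 ≤ n →
      PathFactor.IsKConnected (n + r + 1) (PathFactor.completeJoinK2 (n + r + 1) (2 * r + 2)) ∧
      ((((n : ℝ) + 3 * ((r : ℝ) + 2)) / (2 * ((r : ℝ) + 2)) : ℝ) : EReal)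
        < PathFactor.isolatedToughness (PathFactor.completeJoinK2 (n + r + 1) (2 * r + 2)) ∧
      ¬ PathFactor.IsFactorCriticalAvoidable 3 n
        (PathFactor.completeJoinK2 (n + r + 1) (2 * r + 2))) := by
  refine ⟨fun V _ G hG hI => hG.isFactorCriticalAvoidable hI,
    ⟨PathFactor.isKConnected_completeJoinK2 _ (by lia), ?_,
      PathFactor.not_isFactorCriticalAvoidable_completeJoinK2 n (s := r + 2) (by lia)⟩,
    fun hn => ⟨PathFactor.isKConnected_completeJoinK2 _ (by lia), ?_,
      PathFactor.not_isFactorCriticalAvoidable_completeJoinK2 n (s := r + 1) (by lia)⟩⟩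
  · rw [PathFactor.isolatedToughness_completeJoinK2 _ (by lia), EReal.coe_eq_coe_iff,
      div_eq_div_iff (by positivity) (by positivity)]
    push_cast
    ring
  · rw [PathFactor.isolatedToughness_completeJoinK2 _ (by lia), EReal.coe_lt_coe_iff,
      div_lt_div_iff₀ (by positivity) (by positivity)]
    have hn' : (1 : ℝ) ≤ n := by exact_mod_cast hn
    push_cast
    nlinarith
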